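/- For a finite group $G$ let $\mathrm{Frat}(G)$ denote its Frattini subgroup; the elements of $G\setminus\mathrm{Frat}(G)$ are called non-Frattini. Let $p$ and $q$ be two distinct odd primes. Let $S$ be a finite nonabelian simple group, $P$ a faithful irreducible $S$-module of $p$-power order, and $Q$ a faithful irreducible $S$-module of $q$-power order. The triple $(S,P,Q)$ is called a $(p,q)$-Frattini triple if (1) $S$ has no element of order divisible by $pq$; (2) $H^2(S,P)\neq 0$; (3) $H^2(S,Q)\neq 0$; (4) $C_P(s)=0$ for every nontrivial element $s\in S$ of $q$-power order; (5) $C_Q(s)=0$ for every nontrivial element $s\in S$ of $p$-power order. Proposition. Let $p$ and $q$ be two distinct odd primes. Let $G$ be a finite group of minimal order among the finite groups with the following property: $G$ contains an element whose order is divisible by $pq$, but no non-Frattini element $g$ such that $|g|$ is divisible by $pq$ and by no prime different from $p$ and $q$. Then there exists a $(p,q)$-Frattini triple $(S,P,Q)$ such that $G$ is a Frattini extension of $P\times Q$ by $S$, i.e. there is an exact sequence of groups $1\to P\times Q\to G\to S\to 1$ such that the image of $P\times Q$ is contained in $\mathrm{Frat}(G)$ and conjugation in $G$ induces on $P\times Q$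 the given $S$-module structure. -/

import Mathlib

universe u v

/-- The set of elements of `G` whose order is divisible by `p * q`. -/
def Omega (p q : ℕ) (G : Type u) [Group G] : Set G :=
  {g | p * q ∣ orderOf g}

/-- The set of non-Frattini elements of `G` whose order is divisible by `p * q`. -/
def OmegaStar (p q : ℕ) (G : Type u) [Group G] : Set G :=
  Omega p q G \ (frattini G : Set G)

/-- The set of non-Frattini elements of `G` whose order is divisible by `p * q` and by no prime
different from `p` and `q`. -/
def OmegaStarStar (p q : ℕ) (G : Type u) [Group G] : Set G :=
  {g ∈ OmegaStar p q G | ∀ r : ℕ, r.Prime → r ∣ orderOf g → r = p ∨ r = q}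

/-- `G` contains an element of order divisible by `p * q`, but no non-Frattini element whose order
is divisible by `p * q` and by no other primes. -/
def IsExceptional (p q : ℕ) (G : Type u) [Group G] : Prop :=
  (Omega p q G).Nonempty ∧ OmegaStarStar p q G = ∅

/-- `G` has minimal order among the finite groups that are exceptional for `(p, q)`. -/
def IsMinimalExceptional (p q : ℕ) (G : Type u) [Group G] : Prop :=
  IsExceptional p q G ∧
    ∀ (H : Type u) [Group H] [Finite H], IsExceptional p q H → Nat.card G ≤ Nat.card H

/-- The `S`-module `P` (an abelian group with an action `ρ` of `S` by automorphisms, that is, a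
representation over `ℤ`) is faithful, irreducible and of order a power of `p`. -/
structure IsFaithfulIrreducibleOfPrimePower (p : ℕ) {S P : Type v} [Group S] [AddCommGroup P]
    (ρ : Representation ℤ S P) : Prop where
  card_eq : ∃ n : ℕ, Nat.card P = p ^ n
  faithful : Function.Injective ρ
  irreducible : IsSimpleOrder (Subrepresentation ρ)

/-- `(S, P, Q)` is a `(p, q)`-Frattini triple. The actions of `S` on the modules `P` and `Q` are
given by `ρ` and `σ`. -/
structure IsFrattiniTriple (p q : ℕ) {S P Q : Type} [Group S] [AddCommGroup P] [AddCommGroup Q]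
    (ρ : Representation ℤ S P) (σ : Representation ℤ S Q) : Prop where
  finite : Finite S
  simple : IsSimpleGroup S
  nonabelian : ¬ ∀ a b : S, a * b = b * a
  module_left : IsFaithfulIrreducibleOfPrimePower p ρ
  module_right : IsFaithfulIrreducibleOfPrimePower q σ
  omega_eq_empty : Omega p q S = ∅
  cohomology_left : Nontrivial (groupCohomology.H2 (Rep.of ρ))
  cohomology_right : Nontrivial (groupCohomology.H2 (Rep.of σ))
  fixedPointFree_left : ∀ s : S, s ≠ 1 → (∃ n : ℕ, orderOf s = q ^ n) →
    ∀ x : P, ρ s x = x → x = 0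
  fixedPointFree_right : ∀ s : S, s ≠ 1 → (∃ n : ℕ, orderOf s = p ^ n) →
    ∀ y : Q, σ s y = y → y = 0

/-- The extension `1 → P × Q → G → S → 1` is a Frattini extension of the `S`-module `P × Q`
by `S`: conjugation in `G` induces the given action of `S` on `P × Q`, and the kernel
is contained in the Frattini subgroup of `G`. -/
structure IsFrattiniExtension {G : Type u} {S P Q : Type v} [Group G] [Group S]
    [AddCommGroup P] [AddCommGroup Q]
    (ρ : Representation ℤ S P) (σ : Representation ℤ S Q)
    (E : GroupExtension (Multiplicative (P × Q)) G S) : Prop where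
  conj_eq : ∀ (g : G) (x : P) (y : Q),
    g * E.inl (Multiplicative.ofAdd (x, y)) * g⁻¹ =
      E.inl (Multiplicative.ofAdd (ρ (E.rightHom g) x, σ (E.rightHom g) y))
  range_le_frattini : E.inl.range ≤ frattini G

/-! Let F = Frat(G), with Sylow subgroups P for p and Q for q. Elements lift along surjections
without new prime divisors of the order, so by minimality no proper quotient of G has an element of
order divisible by pq. As P and Q commute, every nontrivial normal subgroup then contains P or Q;
hence P and Q are minimal normal and abelian, and F = P × Q. Minimality also gives M = G for every M
≥ F with F ≤ Frat(M). `IsFrattiniConfiguration` records these facts.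

A q-element outside F centralizes no nontrivial x in P, since its product with x would be a
forbidden element. So q-subgroups of S = G/F act freely on P and, q being odd, are cyclic; likewise
with p and q exchanged.

The rest exploits that a nontrivial subgroup of F has no complement in G. A normal M ≥ F with |M :
F| prime to p centralizes P; this gives C(P) = F (`centralizer_left`) and shows that pq divides the
order of every nontrivial normal subgroup of S. Cyclic Sylow subgroups then force such a subgroup to
have index prime to pq (`not_dvd_index_of_isCyclic`). Gaschütz's theorem gives F ≤ Frat(M) for its
preimage M, so M = G and S is simple. Finally, H²(S, P) = 0 would split G/Q over P and produce a
complement of P in G. -/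

/-! ### Elements of controlled order -/

theorem exists_lift_primeFactors {G H : Type*} [Group G] [Finite G] [Group H]
    (f : G →* H) (hf : Function.Surjective f) (y : H) :
    ∃ x, f x = y ∧ ∀ r : ℕ, r.Prime → r ∣ orderOf x → r ∣ orderOf y := by
  -- Take a preimage of least order. If `r` divided only the order of `x`, a power `x ^ k` with `k`
  -- ≡ 1 mod `orderOf y` and `k` ≡ 0 mod `r` would be a smaller preimage.
  obtain ⟨x, hx, hmin⟩ := exists_minimalFor_of_wellFoundedLT (fun x => f x = y) orderOf (hf y)
  refine ⟨x, hx, fun r hr hrx => ?_⟩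
  by_contra hry
  have hc : Nat.Coprime (orderOf y) r := ((Nat.Prime.coprime_iff_not_dvd hr).2 hry).symm
  obtain ⟨k, hk1, hk0⟩ := Nat.chineseRemainder hc 1 0
  have hfx : f (x ^ k) = y := by
    rw [map_pow, hx]
    conv_rhs => rw [← pow_one y]
    exact pow_eq_pow_iff_modEq.2 hk1
  have hrk : r ∣ k := (Nat.modEq_zero_iff_dvd).1 hk0
  have hdvd : orderOf (x ^ k) ∣ orderOf x / r := by
    apply orderOf_dvd_of_pow_eq_one
    rw [← pow_mul, ← orderOf_dvd_iff_pow_eq_one]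
    obtain ⟨l, rfl⟩ := hrk
    obtain ⟨o, ho⟩ := hrx
    rw [ho, Nat.mul_div_cancel_left _ hr.pos]
    exact ⟨l, by ring⟩
  have hpos : 0 < orderOf x / r := Nat.div_pos (Nat.le_of_dvd (orderOf_pos x) hrx) hr.pos
  have hlt : orderOf x / r < orderOf x := Nat.div_lt_self (orderOf_pos x) hr.one_lt
  have h1 := Nat.le_of_dvd hpos hdvd
  have h2 := hmin hfx (by show orderOf (x ^ k) ≤ orderOf x; omega)
  change orderOf x ≤ orderOf (x ^ k) at h2
  omega

theorem exists_lift_orderOf_eq_prime_pow {G H : Type*} [Group G] [Finite G] [Group H]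
    (f : G →* H) (hf : Function.Surjective f) {q : ℕ} (hq : q.Prime) (y : H)
    (hy : ∃ n, orderOf y = q ^ n) : ∃ x, f x = y ∧ ∃ n, orderOf x = q ^ n := by
  obtain ⟨x, hx, hr⟩ := exists_lift_primeFactors f hf y
  obtain ⟨n, hn⟩ := hy
  refine ⟨x, hx, (orderOf x).primeFactorsList.length, ?_⟩
  refine Nat.eq_prime_pow_of_unique_prime_dvd (orderOf_pos x).ne' fun {d} hd hdx => ?_
  exact (Nat.prime_dvd_prime_iff_eq hd hq).1 (hd.dvd_of_dvd_pow (hn ▸ hr d hd hdx))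

theorem exists_mem_notMem_of_dvd_relIndex {G : Type*} [Group G] [Finite G] {q : ℕ}
    (hq : q.Prime) (F M : Subgroup G) (h : q ∣ F.relIndex M) :
    ∃ x ∈ M, x ∉ F ∧ ∃ n, orderOf x = q ^ n := by
  have : Fact q.Prime := ⟨hq⟩
  obtain ⟨R⟩ : Nonempty (Sylow q M) := inferInstance
  by_contra! hcon
  have hRF : (R : Subgroup M) ≤ F.subgroupOf M := by
    intro x hx
    rw [Subgroup.mem_subgroupOf]
    by_contra hxF
    obtain ⟨n, hn⟩ := (IsPGroup.iff_orderOf.1 R.isPGroup') ⟨x, hx⟩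
    refine hcon x x.2 hxF n ?_
    rw [← hn]
    simp
  exact R.not_dvd_index (h.trans (Subgroup.index_dvd_of_le hRF))

/-! ### Complements of abelian normal subgroups -/

/-- A normal abelian subgroup that has a complement in a subgroup of coprime index
has a complement in the whole group. -/
theorem exists_complement_of_coprime_index {E : Type*} [Group E] [Finite E]
    (A H K : Subgroup E) [A.Normal] (hA : ∀ a ∈ A, ∀ b ∈ A, a * b = b * a)
    (hsup : A ⊔ K = H) (hinf : A ⊓ K = ⊥) (hcop : (Nat.card A).Coprime H.index) :
    ∃ L : Subgroup E, A ⊔ L = ⊤ ∧ A ⊓ L = ⊥ := by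
  classical
  have hAH : A ≤ H := hsup ▸ le_sup_left
  -- `κ` is the projection of `H` onto `K` with kernel `A`; its values off `H` are irrelevant.
  have hex : ∀ h : E, ∃ k : E, h ∈ H → k ∈ K ∧ h⁻¹ * k ∈ A := by
    intro h
    by_cases hh : h ∈ H
    · rw [← hsup, sup_comm] at hh
      obtain ⟨k, hk, a, ha, rfl⟩ := Subgroup.mem_sup_of_normal_right.1 hh
      exact ⟨k, fun _ => ⟨hk, by simpa using ha⟩⟩
    · exact ⟨1, fun h => absurd h hh⟩
  choose κ hκ using hex
  have huniq : ∀ k ∈ K, ∀ k' ∈ K, k⁻¹ * k' ∈ A → k = k' := by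
    intro k hk k' hk' h
    have : k⁻¹ * k' ∈ A ⊓ K := ⟨h, K.mul_mem (K.inv_mem hk) hk'⟩
    rw [hinf, Subgroup.mem_bot] at this
    exact inv_mul_eq_one.1 this
  have hκ_eq : ∀ h ∈ H, ∀ k ∈ K, h⁻¹ * k ∈ A → κ h = k := by
    intro h hh k hk hhk
    refine huniq _ (hκ h hh).1 _ hk ?_
    have := A.mul_mem (A.inv_mem (hκ h hh).2) hhk
    simpa [mul_assoc] using this
  have hκ_mul : ∀ h ∈ H, ∀ h' ∈ H, κ (h * h') = κ h * κ h' := by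
    intro h hh h' hh'
    refine hκ_eq _ (H.mul_mem hh hh') _ (K.mul_mem (hκ h hh).1 (hκ h' hh').1) ?_
    have h1 := ‹A.Normal›.conj_mem _ (hκ h hh).2 h'⁻¹
    have := A.mul_mem h1 (hκ h' hh').2
    convert this using 1
    group
  have hκ_A : ∀ a ∈ A, κ a = 1 := fun a ha =>
    hκ_eq a (hAH ha) 1 K.one_mem (by simpa using ha)
  let out : E → E := fun e => (e : E ⧸ H).out
  have hout : ∀ e, (out e)⁻¹ * e ∈ H := fun e => by
    have : ((out e : E) : E ⧸ H) = e := QuotientGroup.out_eq' _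
    exact QuotientGroup.eq.1 this
  have hout_mul : ∀ e, ∀ h ∈ H, out (e * h) = out e := fun e h hh => by
    simp only [out]
    congr 1
    exact QuotientGroup.eq.2 (by simpa using hh)
  -- A section modulo `A` with σ(eh) = σ(e)κ(h) for h in `H`. Hence its factor set `f` depends on
  -- the second argument only modulo `H` and can be multiplied over `E ⧸ H`.
  let σ : E → E := fun e => out e * κ ((out e)⁻¹ * e)
  have hσ_mem : ∀ e, e⁻¹ * σ e ∈ A := fun e => by
    have := (hκ _ (hout e)).2
    simpa [σ, mul_assoc] using this
  have hσ_mul : ∀ e, ∀ h ∈ H, σ (e * h) = σ e * κ h := fun e h hh => by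
    simp only [σ, hout_mul e h hh]
    rw [← mul_assoc (out e)⁻¹ e h, hκ_mul _ (hout e) _ hh, mul_assoc]
  have hσ_A : ∀ e, ∀ a ∈ A, σ (e * a) = σ e := fun e a ha => by
    rw [hσ_mul e a (hAH ha), hκ_A a ha, mul_one]
  have hσ_mk : ∀ e, ((σ e : E) : E ⧸ A) = e := fun e => (QuotientGroup.eq.2 (hσ_mem e)).symm
  let f : E → E → E := fun e e' => σ e * σ e' * (σ (e * e'))⁻¹
  have hf_mem : ∀ e e', f e e' ∈ A := fun e e' => by
    rw [← QuotientGroup.eq_one_iff]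
    simp only [f, QuotientGroup.mk_mul, QuotientGroup.mk_inv, hσ_mk]
    group
  have hf_H : ∀ e e', ∀ h ∈ H, f e (e' * h) = f e e' := fun e e' h hh => by
    simp only [f, ← mul_assoc, hσ_mul _ h hh]
    group
  have hf_A : ∀ e e', ∀ a ∈ A, f (e * a) e' = f e e' := fun e e' a ha => by
    have : e * a * e' = e * e' * (e'⁻¹ * a * e') := by group
    simp only [f]
    rw [this, hσ_A _ a ha, hσ_A _ _ (by simpa using ‹A.Normal›.conj_mem a ha e'⁻¹)]
  let _ : CommGroup A :=
    { (inferInstance : Group A) with mul_comm := fun a b => Subtype.ext (hA a a.2 b b.2) }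
  let _ : Fintype (E ⧸ H) := Fintype.ofFinite _
  let f' : E → E → A := fun e e' => ⟨f e e', hf_mem e e'⟩
  let F : E → E ⧸ H → A := fun e c => f' e c.out
  have hF : ∀ e e' : E, F e (e' : E ⧸ H) = f' e e' := fun e e' => by
    obtain ⟨h, hh⟩ := QuotientGroup.mk_out_eq_mul H e'
    simp only [F, hh]
    exact Subtype.ext (hf_H e e' h h.2)
  let conj : E → A →* A := fun e => (MulAut.conjNormal (σ e) : A ≃* A).toMonoidHom
  have hconj : ∀ e a, ((conj e a : A) : E) = σ e * a * (σ e)⁻¹ := fun e a =>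
    MulAut.conjNormal_apply _ _
  have hcocycle : ∀ e e' c, f' e e' * F (e * e') c = conj e (F e' c) * F e (e' • c) := by
    intro e e' c
    induction c using QuotientGroup.induction_on with
    | H z =>
      have : e' • (z : E ⧸ H) = ((e' * z : E) : E ⧸ H) := rfl
      rw [this, hF, hF, hF]
      apply Subtype.ext
      simp only [Subgroup.coe_mul, hconj]
      simp only [f', f, mul_assoc]
      group
  -- The product of the cocycle identities makes `f' ^ H.index` the coboundary of `g`. Since
  -- `H.index` is prime to the order of `A`, a root `h` of `g` trivializes `f'` itself.
  let g : E → A := fun e => ∏ c, F e c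
  have hg : ∀ e e', f' e e' ^ H.index * g (e * e') = conj e (g e') * g e := by
    intro e e'
    have h1 : ∏ c, (f' e e' * F (e * e') c) = ∏ c, (conj e (F e' c) * F e (e' • c)) :=
      Finset.prod_congr rfl fun c _ => hcocycle e e' c
    rw [Finset.prod_mul_distrib, Finset.prod_mul_distrib, Finset.prod_const, ← map_prod,
      Finset.card_univ, ← Nat.card_eq_fintype_card] at h1
    have h2 : ∏ c, F e (e' • c) = g e := Fintype.prod_equiv (MulAction.toPerm e') _ _ fun _ => rfl
    rw [h2] at h1
    exact h1
  let h : E → A := fun e => (powCoprime hcop).symm (g e)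
  have hh : ∀ e, h e ^ H.index = g e := fun e => (powCoprime hcop).apply_symm_apply (g e)
  have hfh : ∀ e e', f' e e' * h (e * e') = conj e (h e') * h e := by
    intro e e'
    apply (powCoprime hcop).injective
    change (f' e e' * h (e * e')) ^ H.index = (conj e (h e') * h e) ^ H.index
    rw [mul_pow, mul_pow, ← map_pow (conj e), hh, hh, hh, hg]
  have hh_A : ∀ e, ∀ a ∈ A, h (e * a) = h e := fun e a ha => by
    simp only [h, g, F]
    congr 1
    exact Finset.prod_congr rfl fun c _ => Subtype.ext (hf_A e _ a ha)
  -- The corrected section is an endomorphism with kernel `A`; its range is the complement.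
  let τ : E →* E := MonoidHom.mk' (fun e => (h e : E)⁻¹ * σ e) fun e e' => by
    have h1 := congrArg (Subtype.val (p := fun x => x ∈ A)) (hfh e e')
    simp only [Subgroup.coe_mul, hconj] at h1
    simp only [f', f] at h1
    have h2 : σ (e * e') = (h (e * e') : E) * ((h e : E)⁻¹ * (σ e * (h e' : E) * (σ e)⁻¹)⁻¹ * (σ e * σ e')) := by
      rw [← mul_inv_rev, ← h1]
      group
    rw [h2]
    group
  have hτ : ∀ e, τ e = (h e : E)⁻¹ * σ e := fun e => rfl
  have hτ_mk : ∀ e, ((τ e : E) : E ⧸ A) = e := fun e => by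
    rw [hτ, QuotientGroup.mk_mul, hσ_mk, QuotientGroup.mk_inv,
      (QuotientGroup.eq_one_iff _).2 (h e).2, inv_one, one_mul]
  have hτ_A : ∀ a ∈ A, τ a = 1 := fun a ha => by
    rw [← map_one τ, ← one_mul a, hτ, hτ, hh_A 1 a ha, hσ_A 1 a ha]
  refine ⟨τ.range, ?_, ?_⟩
  · rw [eq_top_iff]
    intro e _
    have h1 : e * (τ e)⁻¹ ∈ A := by
      rw [← QuotientGroup.eq_one_iff, QuotientGroup.mk_mul, QuotientGroup.mk_inv, hτ_mk]
      group
    have := Subgroup.mul_mem_sup h1 (MonoidHom.mem_range.2 ⟨e, rfl⟩ : τ e ∈ τ.range)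
    simpa using this
  · rw [eq_bot_iff]
    rintro _ ⟨h1, e, rfl⟩
    rw [Subgroup.mem_bot]
    apply hτ_A
    rw [← QuotientGroup.eq_one_iff, ← hτ_mk]
    exact (QuotientGroup.eq_one_iff _).2 h1

/-- Two complements of a normal abelian subgroup of coprime order are conjugate. -/
theorem exists_conj_mem_of_complement {G : Type*} [Group G] [Finite G]
    (A K L : Subgroup G) [A.Normal] (hA : ∀ a ∈ A, ∀ b ∈ A, a * b = b * a)
    (hinf : A ⊓ L = ⊥) (hKL : K ≤ A ⊔ L)
    (hcop : (Nat.card A).Coprime (Nat.card K)) :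
    ∃ a ∈ A, ∀ x ∈ K, a⁻¹ * x * a ∈ L := by
  classical
  have hex : ∀ x : K, ∃ l ∈ L, (x : G) * l⁻¹ ∈ A := by
    intro x
    obtain ⟨a, ha, l, hl, h⟩ := Subgroup.mem_sup_of_normal_left.1 (hKL x.2)
    exact ⟨l, hl, by simpa [← h] using ha⟩
  choose κ hκL hκA using hex
  have hκ_mul : ∀ x y, κ (x * y) = κ x * κ y := by
    intro x y
    have h1 : κ (x * y) * (κ x * κ y)⁻¹ ∈ A ⊓ L := by
      refine ⟨?_, L.mul_mem (hκL _) (L.inv_mem (L.mul_mem (hκL _) (hκL _)))⟩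
      have hx : ∀ x, ((κ x : G) : G ⧸ A) = (x : G) := fun x => by
        have := (QuotientGroup.eq_one_iff _).2 (hκA x)
        rw [QuotientGroup.mk_mul, QuotientGroup.mk_inv, mul_inv_eq_one] at this
        exact this.symm
      refine (QuotientGroup.eq_one_iff _).1 ?_
      rw [QuotientGroup.mk_mul, QuotientGroup.mk_inv, QuotientGroup.mk_mul, hx, hx, hx, Subgroup.coe_mul, QuotientGroup.mk_mul]
      group
    rw [hinf, Subgroup.mem_bot] at h1
    exact mul_inv_eq_one.1 h1
  let _ : CommGroup A :=
    { (inferInstance : Group A) with mul_comm := fun a b => Subtype.ext (hA a a.2 b b.2) }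
  let _ : Fintype K := Fintype.ofFinite _
  -- A 1-cocycle. Averaging it over `K` and extracting a root of order |K| gives the conjugating
  -- element.
  let d : K → A := fun x => ⟨x * (κ x)⁻¹, hκA x⟩
  let conj : K → A →* A := fun e => (MulAut.conjNormal (e : G) : A ≃* A).toMonoidHom
  have hconj : ∀ e a, ((conj e a : A) : G) = e * a * (e : G)⁻¹ := fun e a =>
    MulAut.conjNormal_apply _ _
  have hd : ∀ x y, d (x * y) = conj x (d y) * d x := by
    intro x y
    apply Subtype.ext
    simp only [Subgroup.coe_mul, hconj]
    simp only [d, hκ_mul, Subgroup.coe_mul]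
    group
  let D : A := ∏ y, d y
  have hD : ∀ x, D = conj x D * d x ^ Nat.card K := by
    intro x
    have h1 : ∏ y, d (x * y) = ∏ y, (conj x (d y) * d x) :=
      Finset.prod_congr rfl fun y _ => hd x y
    rw [Finset.prod_mul_distrib, Finset.prod_const, ← map_prod,
      Finset.card_univ, ← Nat.card_eq_fintype_card] at h1
    rw [← h1]
    exact (Fintype.prod_equiv (Equiv.mulLeft x) _ _ fun _ => rfl).symm
  obtain ⟨a, ha⟩ := (powCoprime hcop).surjective D
  change a ^ Nat.card K = D at ha
  have had : ∀ x, a = conj x a * d x := by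
    intro x
    apply (powCoprime hcop).injective
    change a ^ Nat.card K = (conj x a * d x) ^ Nat.card K
    rw [mul_pow, ← map_pow (conj x), ha, ← hD]
  refine ⟨a, a.2, fun x hx => ?_⟩
  have h1 := congrArg (Subtype.val (p := fun x => x ∈ A)) (had ⟨x, hx⟩)
  simp only [Subgroup.coe_mul, hconj] at h1
  simp only [d] at h1
  have h2 : (a : G)⁻¹ * x * a = κ ⟨x, hx⟩ := by
    have h3 : x * a = a * κ ⟨x, hx⟩ := by
      conv_rhs => rw [h1]
      group
    rw [mul_assoc, h3, inv_mul_cancel_left]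
  rw [h2]
  exact hκL _

theorem eq_top_of_le_frattini_of_sup_eq_top {G : Type*} [Group G] [Finite G] {A L : Subgroup G}
    (hA : A ≤ frattini G) (h : A ⊔ L = ⊤) : L = ⊤ := by
  apply frattini_nongenerating
  rw [eq_top_iff, ← h, sup_comm]
  exact sup_le_sup_left hA L

/-- If a normal abelian subgroup `A` is contained in the Frattini subgroup and is a Hall subgroup
of a normal subgroup `M`, then it has a normal complement in `M`. -/
theorem exists_normal_complement {G : Type*} [Group G] [Finite G]
    (A M : Subgroup G) [A.Normal] [M.Normal] (hA : ∀ a ∈ A, ∀ b ∈ A, a * b = b * a)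
    (hAF : A ≤ frattini G) (hAM : A ≤ M) (hcop : (Nat.card A).Coprime (A.relIndex M)) :
    ∃ K : Subgroup G, K.Normal ∧ A ⊔ K = M ∧ A ⊓ K = ⊥ := by
  have hcardA : Nat.card (A.subgroupOf M) = Nat.card A :=
    Nat.card_congr (Subgroup.subgroupOfEquivOfLe hAM).toEquiv
  obtain ⟨K₀, hK₀⟩ := Subgroup.exists_right_complement'_of_coprime
    (N := A.subgroupOf M) (by rw [hcardA]; exact hcop)
  have hmap : (A.subgroupOf M).map M.subtype = A := Subgroup.map_subgroupOf_eq_of_le hAM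
  have hsup : A ⊔ K₀.map M.subtype = M := by
    rw [← hmap, ← Subgroup.map_sup, hK₀.sup_eq_top, ← MonoidHom.range_eq_map,
      Subgroup.range_subtype]
  have hinf : A ⊓ K₀.map M.subtype = ⊥ := by
    rw [← hmap, ← Subgroup.map_inf _ _ _ M.subtype_injective, hK₀.disjoint.eq_bot,
      Subgroup.map_bot]
  have hcard : Nat.card (K₀.map M.subtype) = A.relIndex M := by
    rw [Subgroup.card_map_of_injective M.subtype_injective]
    exact hK₀.symm.index_eq_card.symm
  generalize K₀.map M.subtype = K at hsup hinf hcard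
  refine ⟨K, ?_, hsup, hinf⟩
  -- Frattini argument: `K` and its conjugates are complements of `A` in `M`, hence conjugate under
  -- `A`. So `A` and the normalizer of `K` generate `G`, and `A` is superfluous.
  rw [← Subgroup.normalizer_eq_top_iff]
  apply eq_top_of_le_frattini_of_sup_eq_top hAF
  rw [eq_top_iff]
  intro g _
  have hgA : A.map ((MulAut.conj g : G ≃* G) : G →* G) = A := Subgroup.Normal.map_conj_eq A g
  have hgM : M.map ((MulAut.conj g : G ≃* G) : G →* G) = M := Subgroup.Normal.map_conj_eq M g
  obtain ⟨a, haA, ha⟩ := exists_conj_mem_of_complement A K (K.map ((MulAut.conj g : G ≃* G) : G →* G)) hA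
    (by
      conv_lhs => rw [← hgA]
      rw [← Subgroup.map_inf _ _ _ (MulAut.conj g).injective, hinf, Subgroup.map_bot])
    (by
      conv_rhs => rw [← hgA]
      rw [← Subgroup.map_sup, hsup, hgM, ← hsup]
      exact le_sup_right)
    (by rw [hcard]; exact hcop)
  have hnorm : a * g ∈ Subgroup.normalizer (K : Set G) := by
    have : K.map ((MulAut.conj g : G ≃* G) : G →* G) = K.map ((MulAut.conj a⁻¹ : G ≃* G) : G →* G) := by
      symm
      apply Subgroup.eq_of_le_of_card_ge
      · rintro _ ⟨x, hx, rfl⟩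
        simpa using ha x hx
      · rw [Subgroup.card_map_of_injective (MulAut.conj g).injective,
          Subgroup.card_map_of_injective (MulAut.conj a⁻¹).injective]
    rw [Subgroup.mem_normalizer_iff]
    intro x
    constructor
    · intro hx
      obtain ⟨k, hk, h⟩ := this ▸ Subgroup.mem_map_of_mem _ hx
      simp only [MonoidHom.coe_coe, MulAut.conj_apply, inv_inv] at h
      have h1 : a * g * x * (a * g)⁻¹ = k := by
        rw [show a * g * x * (a * g)⁻¹ = a * (g * x * g⁻¹) * a⁻¹ by group, ← h]
        group
      rwa [h1]
    · intro hx
      obtain ⟨k, hk, h⟩ := this.symm ▸ Subgroup.mem_map_of_mem _ hx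
      simp only [MonoidHom.coe_coe, MulAut.conj_apply, inv_inv] at h
      have h1 : x = k := by
        have : g * x * g⁻¹ = g * k * g⁻¹ := by rw [h]; group
        simpa using this
      rwa [h1]
  have := Subgroup.mul_mem_sup (A.inv_mem haA) hnorm
  simpa using this

/-- A normal abelian subgroup that meets the Frattini subgroup trivially has a complement. -/
theorem exists_complement_of_inf_frattini_eq_bot {M : Type*} [Group M] [Finite M]
    (A : Subgroup M) [A.Normal] (hA : ∀ a ∈ A, ∀ b ∈ A, a * b = b * a)
    (h : A ⊓ frattini M = ⊥) : ∃ L : Subgroup M, A ⊔ L = ⊤ ∧ A ⊓ L = ⊥ := by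
  -- For a minimal supplement `L`, the group `A ⊓ L` is normal. A maximal subgroup `U` not
  -- containing it would yield the smaller supplement `U ⊓ L`.
  obtain ⟨L, hL, hmin⟩ := exists_minimal_of_wellFoundedLT (fun L : Subgroup M => A ⊔ L = ⊤)
    ⟨⊤, by simp⟩
  refine ⟨L, hL, ?_⟩
  have hnorm : (A ⊓ L).Normal := by
    rw [← Subgroup.normalizer_eq_top_iff, eq_top_iff, ← hL]
    refine sup_le (fun a ha => ?_) ?_
    · rw [Subgroup.mem_normalizer_iff]
      intro x
      constructor
      · rintro hx
        rw [hA a ha x hx.1]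
        simpa using hx
      · intro hx
        have := hA a ha _ hx.1
        have h2 : a * x * a⁻¹ = x := by
          have h3 : a * (a * x * a⁻¹) = a * x := by rw [this]; group
          exact mul_left_cancel h3
        rwa [h2] at hx
    · intro l hl
      rw [Subgroup.mem_normalizer_iff]
      intro x
      refine and_congr ?_ ?_
      · constructor
        · intro hx; exact ‹A.Normal›.conj_mem x hx l
        · intro hx
          have := ‹A.Normal›.conj_mem _ hx l⁻¹
          simpa [mul_assoc] using this
      · change x ∈ L ↔ l * x * l⁻¹ ∈ L
        rw [Subgroup.mul_mem_cancel_right _ (L.inv_mem hl), Subgroup.mul_mem_cancel_left _ hl]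
  rw [eq_bot_iff, ← h]
  refine le_inf inf_le_left ?_
  simp only [frattini, Order.radical, le_iInf_iff]
  intro U hU
  by_contra hAU
  have htop : (A ⊓ L) ⊔ U = ⊤ := by
    rw [sup_comm]
    exact hU.2 _ (by simpa using hAU)
  have h1 : A ⊔ (U ⊓ L) = ⊤ := by
    rw [eq_top_iff, ← hL]
    refine sup_le le_sup_left fun l hl => ?_
    have : l ∈ (A ⊓ L) ⊔ U := htop ▸ Subgroup.mem_top l
    obtain ⟨y, hy, u, hu, rfl⟩ := Subgroup.mem_sup_of_normal_left.1 this
    refine Subgroup.mul_mem_sup hy.1 ⟨hu, ?_⟩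
    exact (Subgroup.mul_mem_cancel_left _ hy.2).1 hl
  have h2 : L ≤ U ⊓ L := hmin h1 inf_le_right
  have h3 : U = ⊤ := by
    rw [← htop, eq_comm, sup_eq_right]
    exact inf_le_right.trans (h2.trans inf_le_left)
  exact hU.1 h3

/-! ### Cyclic Sylow subgroups and fixed-point-free actions -/

/-- If a finite group `S` has cyclic `q`-subgroups and every nontrivial normal subgroup has order
divisible by `p * q`, then no nontrivial normal subgroup has index divisible by `q`. -/
theorem not_dvd_index_of_isCyclic {S : Type*} [Group S] [Finite S] {p q : ℕ} (hq : q.Prime)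
    (hp : p.Prime) (hpq : p ≠ q)
    (hcyc : ∀ R : Subgroup S, IsPGroup q R → IsCyclic R)
    (hnorm : ∀ T : Subgroup S, T.Normal → T ≠ ⊥ → p ∣ Nat.card T ∧ q ∣ Nat.card T)
    (T : Subgroup S) [T.Normal] (hT : T ≠ ⊥) : ¬ q ∣ T.index := by
  have : Fact q.Prime := ⟨hq⟩
  intro hdvd
  rw [← Subgroup.relIndex_top_right] at hdvd
  obtain ⟨x, -, hxT, n, hn⟩ := exists_mem_notMem_of_dvd_relIndex hq T ⊤ hdvd
  -- `H / T` is a nontrivial cyclic `q`-group, so `q` divides the index of the derived subgroup of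
  -- `H`. As the Sylow `q`-subgroup of `H` is cyclic, `q` cannot also divide the order of the
  -- derived subgroup; so `⁅T, T⁆` must be trivial.
  set H := T ⊔ Subgroup.zpowers x with hH
  have hTH : T ≤ H := le_sup_left
  have hxH : x ∈ H := (le_sup_right : _ ≤ H) (Subgroup.mem_zpowers x)
  obtain ⟨R⟩ : Nonempty (Sylow q H) := inferInstance
  have hRcyc : IsCyclic R := by
    have h1 := hcyc ((R : Subgroup H).map H.subtype) (R.isPGroup'.map _)
    exact isCyclic_of_injective (R.1.equivMapOfInjective _ H.subtype_injective).toMonoidHom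
      (MulEquiv.injective _)
  have hcomm : commutator H ≤ T.subgroupOf H := by
    rw [commutator_def, Subgroup.commutator_le]
    have hle : H ≤ (Subgroup.zpowers (x : S ⧸ T)).comap (QuotientGroup.mk' T) := by
      refine sup_le (fun t ht => ?_) ?_
      · rw [Subgroup.mem_comap, QuotientGroup.mk'_apply, (QuotientGroup.eq_one_iff t).2 ht]
        exact Subgroup.one_mem _
      · rw [Subgroup.zpowers_le]
        exact Subgroup.mem_zpowers _
    intro a _ b _
    obtain ⟨i, hi⟩ := hle a.2
    obtain ⟨j, hj⟩ := hle b.2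
    rw [Subgroup.mem_subgroupOf, ← QuotientGroup.eq_one_iff]
    simp only [QuotientGroup.mk'_apply] at hi hj
    simp only [commutatorElement_def, Subgroup.coe_mul, InvMemClass.coe_inv, QuotientGroup.mk_mul,
      QuotientGroup.mk_inv, ← hi, ← hj]
    group
  have hindex : q ∣ (commutator H).index := by
    refine dvd_trans ?_ (Subgroup.index_dvd_of_le hcomm)
    have h1 : orderOf (((⟨x, hxH⟩ : H) : H ⧸ T.subgroupOf H)) ∣ q ^ n := by
      rw [← hn]
      refine (orderOf_map_dvd (QuotientGroup.mk' (T.subgroupOf H)) (⟨x, hxH⟩ : H)).trans ?_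
      simp
    obtain ⟨k, -, hk⟩ := (Nat.dvd_prime_pow hq).1 h1
    have hk0 : k ≠ 0 := by
      rintro rfl
      rw [pow_zero, orderOf_eq_one_iff, QuotientGroup.eq_one_iff, Subgroup.mem_subgroupOf] at hk
      exact hxT hk
    refine (dvd_pow_self q hk0).trans ?_
    rw [← hk]
    exact orderOf_dvd_natCard _
  have hcard : ¬ q ∣ Nat.card (commutator H) :=
    (R.not_dvd_card_commutator_or_not_dvd_index_commutator).resolve_right (not_not.2 hindex)
  have hTcomm : ⁅T, T⁆ = ⊥ := by
    by_contra hne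
    have h1 : ⁅T, T⁆ ≤ (commutator H).map H.subtype := by
      rw [Subgroup.map_subtype_commutator]
      exact Subgroup.commutator_mono hTH hTH
    apply hcard
    rw [← Subgroup.card_map_of_injective H.subtype_injective (K := commutator H)]
    exact (hnorm _ inferInstance hne).2.trans (Subgroup.card_dvd_of_le h1)
  have hTab : IsMulCommutative T := by
    rw [Subgroup.commutator_eq_bot_iff_le_centralizer] at hTcomm
    exact ⟨⟨fun a b => Subtype.ext (hTcomm b.2 a a.2)⟩⟩
  -- In the abelian group `T` this subgroup is characteristic, hence normal in `S`, but `p` does not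
  -- divide its order.
  obtain ⟨R'⟩ : Nonempty (Sylow q T) := inferInstance
  have hR'n : (R' : Subgroup T).Normal :=
    ⟨fun a ha b => by rw [hTab.is_comm.comm b a, mul_inv_cancel_right]; exact ha⟩
  have hR'c : (R' : Subgroup T).Characteristic := R'.characteristic_of_normal hR'n
  have hR'ne : (R' : Subgroup T).map T.subtype ≠ ⊥ := by
    intro h
    have h1 : (R' : Subgroup T) = ⊥ := by
      rwa [Subgroup.map_eq_bot_iff_of_injective _ T.subtype_injective] at h
    have h2 := R'.not_dvd_index
    rw [h1, Subgroup.index_bot] at h2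
    exact h2 (hnorm T inferInstance hT).2
  have h3 := (hnorm _ inferInstance hR'ne).1
  rw [Subgroup.card_map_of_injective T.subtype_injective] at h3
  obtain ⟨k, hk⟩ := IsPGroup.iff_card.1 R'.isPGroup'
  rw [hk] at h3
  exact hpq ((Nat.prime_dvd_prime_iff_eq hp hq).1 (hp.dvd_of_dvd_pow h3))

/-- Modulo p², mʲ is 1 + jpt, and the sum p(p-1)/2 of the j is a multiple of p because p is odd. -/
theorem Int.sum_range_pow_modEq_of_odd {p : ℕ} (hp : Odd p) (m t : ℤ) (hm : m = 1 + p * t) :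
    ∃ u : ℤ, ∑ j ∈ Finset.range p, m ^ j = p + p ^ 2 * u := by
  have h1 : ∀ j : ℕ, ∃ w : ℤ, m ^ j = 1 + j * (p * t) + p ^ 2 * w := by
    intro j
    induction j with
    | zero => exact ⟨0, by simp⟩
    | succ j ih =>
      obtain ⟨w, hw⟩ := ih
      refine ⟨w + w * p * t + j * t * t, ?_⟩
      rw [pow_succ, hw, hm]
      push_cast
      ring
  choose w hw using h1
  obtain ⟨r, hr⟩ := hp
  refine ⟨r * t + ∑ j ∈ Finset.range p, w j, ?_⟩
  have h2 : (∑ j ∈ Finset.range p, (j : ℤ)) = p * r := by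
    have h3 := Finset.sum_range_id_mul_two p
    have h4 : (p - 1) = 2 * r := by omega
    rw [h4] at h3
    have h5 : ∑ j ∈ Finset.range p, j = p * r := by
      have : (∑ j ∈ Finset.range p, j) * 2 = (p * r) * 2 := by rw [h3]; ring
      omega
    rw [← Nat.cast_sum, h5, Nat.cast_mul]
  simp_rw [hw]
  rw [Finset.sum_add_distrib, Finset.sum_add_distrib, ← Finset.sum_mul, ← Finset.mul_sum, h2]
  simp
  ring

theorem mul_pow_of_conj_eq_zpow {G : Type*} [Group G] {a b : G} {m : ℤ} (h : b * a * b⁻¹ = a ^ m)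
    (i : ℤ) (j : ℕ) : (a ^ i * b) ^ j = a ^ (i * ∑ t ∈ Finset.range j, m ^ t) * b ^ j := by
  have hk : ∀ k : ℤ, b * a ^ k = a ^ (m * k) * b := by
    intro k
    rw [zpow_mul, ← h, conj_zpow]
    group
  induction j with
  | zero => simp
  | succ j ih =>
    rw [pow_succ', ih, Finset.sum_range_succ', pow_succ' b]
    have h1 : ∑ k ∈ Finset.range j, m ^ (k + 1) = m * ∑ k ∈ Finset.range j, m ^ k := by
      rw [Finset.mul_sum]
      exact Finset.sum_congr rfl fun _ _ => pow_succ' _ _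
    rw [h1, mul_assoc (a ^ i), ← mul_assoc b, hk, mul_assoc _ b, ← mul_assoc, ← zpow_add]
    congr 2
    ring

/-- A finite `p`-group, `p` odd, without noncyclic elementary abelian subgroups is cyclic. -/
theorem IsPGroup.isCyclic_of_forall_commute {p : ℕ} (hp : p.Prime) (hodd : Odd p) :
    ∀ (n : ℕ) {G : Type*} [Group G] [Finite G], Nat.card G = p ^ n →
    (∀ x y : G, Commute x y → x ^ p = 1 → y ^ p = 1 → y ≠ 1 → x ∈ Subgroup.zpowers y) →
    IsCyclic G := by
  have : Fact p.Prime := ⟨hp⟩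
  intro n
  induction n with
  | zero =>
    intro G _ _ hcard _
    have := (Nat.card_eq_one_iff_unique.1 (by simpa using hcard)).1
    infer_instance
  | succ n ih =>
    intro G _ _ hcard h
    obtain ⟨A, hA⟩ := Sylow.exists_subgroup_card_pow_prime p
      (show p ^ n ∣ Nat.card G from hcard ▸ pow_dvd_pow p n.le_succ)
    have hindex : A.index = p := by
      have := A.card_mul_index
      rw [hA, hcard, pow_succ] at this
      exact Nat.eq_of_mul_eq_mul_left (pow_pos hp.pos n) this
    have hAn : A.Normal := by
      apply Subgroup.normal_of_index_eq_minFac_card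
      rw [hindex, hcard, Nat.Prime.pow_minFac hp n.succ_ne_zero]
    have hAc : IsCyclic A := by
      apply ih hA
      intro x y hxy hx hy hy1
      obtain ⟨k, hk⟩ := h x y (congrArg Subtype.val hxy) (by exact_mod_cast hx)
        (by exact_mod_cast hy) (by simpa using hy1)
      exact ⟨k, Subtype.ext (by simpa using hk)⟩
    -- With trivial `A` split off, `A` has order `p ^ (n + 1)` for the new `n`, and `a ^ p ^ n` will
    -- have order `p`.
    rcases n with _ | n
    · exact isCyclic_of_prime_card (p := p) (by simpa using hcard)
    obtain ⟨⟨a, haA⟩, ha⟩ := hAc.exists_generator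
    have haz : ∀ x ∈ A, ∃ k : ℤ, a ^ k = x := by
      intro x hx
      obtain ⟨k, hk⟩ := ha ⟨x, hx⟩
      exact ⟨k, by simpa using congrArg Subtype.val hk⟩
    have hao : orderOf a = p ^ (n + 1) := by
      have := orderOf_eq_card_of_forall_mem_zpowers ha
      rw [hA] at this
      rw [← this]
      exact (Subgroup.orderOf_mk a haA).symm
    obtain ⟨b, hb⟩ : ∃ b, b ∉ A := by
      by_contra! hcon
      have : A = ⊤ := by ext; simp [hcon]
      rw [this, Subgroup.index_top] at hindex
      exact hp.one_lt.ne hindex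
    obtain ⟨m, hm⟩ := haz _ (hAn.conj_mem a haA b)
    have hbp : b ^ p ∈ A := by
      rw [← hindex]
      exact Subgroup.pow_index_mem A b
    obtain ⟨k, hk⟩ := haz _ hbp
    -- `b ^ p` lies in `A` and centralizes `a`, so mᵖ ≡ 1 modulo `p`; then Fermat applies.
    have hcongr : (p : ℤ) ∣ m - 1 := by
      have h1 : ∀ j : ℕ, b ^ j * a * (b ^ j)⁻¹ = a ^ (m ^ j) := by
        intro j
        induction j with
        | zero => simp
        | succ j ihj =>
          rw [pow_succ' m, zpow_mul, hm, conj_zpow, ← ihj]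
          group
      have h2 := h1 p
      rw [← hk] at h2
      have h3 : a ^ (m ^ p - 1) = 1 := by
        rw [zpow_sub_one, ← h2]
        group
      have h4 : (p : ℤ) ∣ m ^ p - 1 := by
        refine dvd_trans ?_ (orderOf_dvd_iff_zpow_eq_one.2 h3)
        rw [hao, pow_succ']
        push_cast
        exact dvd_mul_right _ _
      rw [← ZMod.intCast_zmod_eq_zero_iff_dvd] at h4 ⊢
      push_cast at h4 ⊢
      rwa [ZMod.pow_card] at h4
    -- If `p` divides `k`, some `a ^ i * b` outside `A` has `p`-th power 1 and commutes with `a ^ p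
    -- ^ n`, against `h`. Otherwise `a` is a power of `b`, and `b` generates `G`.
    by_cases hpk : (p : ℤ) ∣ k
    · exfalso
      obtain ⟨t, ht⟩ := hcongr
      obtain ⟨u, hu⟩ := Int.sum_range_pow_modEq_of_odd hodd m t (by linarith)
      obtain ⟨k', rfl⟩ := hpk
      have hcop : IsCoprime (1 + p * u : ℤ) ((p : ℤ) ^ n) := by
        apply IsCoprime.pow_right
        exact ⟨1, -u, by ring⟩
      -- `c` inverts 1 + pu modulo pⁿ, so the exponent -k'c cancels `b ^ p`, which is a to the power
      -- pk'.
      obtain ⟨c, d, hcd⟩ := hcop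
      have hy : (a ^ (-k' * c) * b) ^ p = 1 := by
        rw [mul_pow_of_conj_eq_zpow hm.symm, hu, ← hk, ← zpow_add, ← orderOf_dvd_iff_zpow_eq_one,
          hao]
        refine ⟨k' * d, ?_⟩
        push_cast
        linear_combination (-(p : ℤ) * k') * hcd
      have hz : (a ^ p ^ n) ^ p = 1 := by
        rw [← pow_mul, ← pow_succ, ← hao, pow_orderOf_eq_one]
      have hz1 : a ^ p ^ n ≠ 1 := by
        rw [Ne, ← orderOf_dvd_iff_pow_eq_one, hao]
        intro hdvd
        have := (Nat.pow_dvd_pow_iff_le_right hp.one_lt).1 hdvd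
        omega
      have hcomm : Commute (a ^ (-k' * c) * b) (a ^ p ^ n) := by
        refine Commute.mul_left ((Commute.refl a).zpow_left _ |>.pow_right _) ?_
        have h1 : b * a ^ p ^ n * b⁻¹ = a ^ p ^ n := by
          rw [← conj_pow, ← hm, ← zpow_natCast, ← zpow_natCast, ← zpow_mul,
            zpow_eq_zpow_iff_modEq, hao]
          refine Int.modEq_iff_dvd.2 ⟨-t, ?_⟩
          push_cast
          linear_combination (-(p : ℤ) ^ n) * ht
        exact mul_inv_eq_iff_eq_mul.1 h1
      obtain ⟨j, hj⟩ := h _ _ hcomm hy hz hz1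
      apply hb
      have h2 : a ^ (-k' * c) * b ∈ A := hj ▸ A.zpow_mem (A.pow_mem haA _) _
      exact (Subgroup.mul_mem_cancel_left _ (A.zpow_mem haA _)).1 h2
    · have hlt : A < Subgroup.zpowers b := by
        have h1 : a ∈ Subgroup.zpowers b := by
          have hcop : IsCoprime k (p ^ (n + 1) : ℤ) :=
            IsCoprime.pow_right ((Nat.prime_iff_prime_int.1 hp).coprime_iff_not_dvd.2 hpk).symm
          obtain ⟨c, d, hcd⟩ := hcop
          refine ⟨p * c, ?_⟩
          simp only
          rw [zpow_mul, zpow_natCast, ← hk, ← zpow_mul]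
          have h2 : k * c = 1 - p ^ (n + 1) * d := by linarith
          rw [h2, zpow_sub, zpow_mul, ← Nat.cast_pow, ← hao, zpow_natCast, pow_orderOf_eq_one]
          simp
        refine lt_of_le_of_ne (fun x hx => ?_) ?_
        · obtain ⟨j, rfl⟩ := haz x hx
          exact Subgroup.zpow_mem _ h1 _
        · intro heq
          exact hb (heq ▸ Subgroup.mem_zpowers b)
      have htop : Subgroup.zpowers b = ⊤ := by
        have h1 := Subgroup.relIndex_mul_index hlt.le
        rw [hindex] at h1
        rcases (Nat.dvd_prime hp).1 (Dvd.intro_left _ h1) with h2 | h2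
        · exact Subgroup.index_eq_one.1 h2
        · rw [h2] at h1
          have h3 : A.relIndex (Subgroup.zpowers b) = 1 := Nat.eq_of_mul_eq_mul_right hp.pos (by simpa using h1)
          exact absurd (Subgroup.relIndex_eq_one.1 h3) (not_le_of_gt hlt)
      exact isCyclic_iff_exists_zpowers_eq_top.2 ⟨b, htop⟩

/-- Commuting operators `x`, `y` of prime order `q` that generate a noncyclic group cannot act
without fixed points on a module without `q`-torsion. -/
theorem Representation.nsmul_eq_zero_of_fixedPointFree {S V : Type*} [Group S] [AddCommGroup V]
    (ρ : Representation ℤ S V) {q : ℕ} (hq : q.Prime)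
    (hfree : ∀ s : S, s ≠ 1 → s ^ q = 1 → ∀ v, ρ s v = v → v = 0)
    {x y : S} (hxy : Commute x y) (hx : x ^ q = 1) (hy : y ^ q = 1) (hy1 : y ≠ 1)
    (hxy' : x ∉ Subgroup.zpowers y) (v : V) : q • v = 0 := by
  have : Fact q.Prime := ⟨hq⟩
  have hsum : ∀ s : S, s ≠ 1 → s ^ q = 1 → ∀ v, ∑ i ∈ Finset.range q, ρ (s ^ i) v = 0 := by
    intro s hs1 hs v
    apply hfree s hs1 hs
    rw [map_sum]
    have h1 : ∀ i, ρ s (ρ (s ^ i) v) = ρ (s ^ (i + 1)) v := fun i => by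
      rw [pow_succ', map_mul, Module.End.mul_apply]
    simp_rw [h1]
    have h2 := Finset.sum_range_succ (fun i => ρ (s ^ i) v) q
    rw [Finset.sum_range_succ', hs] at h2
    simpa using h2
  -- Add the norms of the elements `x * y ^ j`; each vanishes because its values are fixed points.
  -- The terms with i = 0 contribute `q • v`, while for each i > 0 the sum over j is a translate of
  -- the norm of a nontrivial power of `y`, again zero.
  have h1 : ∑ j ∈ Finset.range q, ∑ i ∈ Finset.range q, ρ ((x * y ^ j) ^ i) v = 0 := by
    refine Finset.sum_eq_zero fun j _ => hsum _ ?_ ?_ v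
    · intro h
      apply hxy'
      rw [eq_inv_of_mul_eq_one_left h]
      exact Subgroup.inv_mem _ (Subgroup.pow_mem _ (Subgroup.mem_zpowers y) j)
    · rw [(hxy.pow_right j).mul_pow, hx, one_mul, ← pow_mul, mul_comm, pow_mul, hy, one_pow]
  rw [Finset.sum_comm, ← Nat.sub_one_add_one hq.ne_zero, Finset.sum_range_succ',
    Nat.sub_one_add_one hq.ne_zero] at h1
  rw [Finset.sum_eq_zero, zero_add] at h1
  · simpa using h1
  · intro i hi
    have h2 : ∀ j, ρ ((x * y ^ j) ^ (i + 1)) v = ρ (x ^ (i + 1)) (ρ ((y ^ (i + 1)) ^ j) v) := by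
      intro j
      rw [(hxy.pow_right j).mul_pow, map_mul, Module.End.mul_apply, ← pow_mul, ← pow_mul, mul_comm j]
    simp_rw [h2]
    rw [← map_sum, hsum, map_zero]
    · intro h3
      have := orderOf_eq_prime hy hy1
      have h4 := Nat.le_of_dvd i.succ_pos (orderOf_dvd_of_pow_eq_one h3)
      rw [Finset.mem_range] at hi
      omega
    · rw [← pow_mul, mul_comm, pow_mul, hy, one_pow]

theorem mul_dvd_orderOf_mul {G : Type*} [Group G] {p q : ℕ} (hp : p.Prime) (hq : q.Prime)
    (hpq : p ≠ q) {x y : G} (hxy : Commute x y) (hx1 : x ≠ 1) (hy1 : y ≠ 1)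
    (hx : ∃ n, orderOf x = p ^ n) (hy : ∃ n, orderOf y = q ^ n) : p * q ∣ orderOf (x * y) := by
  obtain ⟨n, hn⟩ := hx
  obtain ⟨m, hm⟩ := hy
  have hcop : (orderOf x).Coprime (orderOf y) := by
    rw [hn, hm]
    exact Nat.Coprime.pow _ _ ((Nat.coprime_primes hp hq).2 hpq)
  have hn0 : n ≠ 0 := by
    rintro rfl
    exact hx1 (orderOf_eq_one_iff.1 (by simpa using hn))
  have hm0 : m ≠ 0 := by
    rintro rfl
    exact hy1 (orderOf_eq_one_iff.1 (by simpa using hm))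
  rw [hxy.orderOf_mul_eq_mul_orderOf_of_coprime hcop, hn, hm]
  exact mul_dvd_mul (dvd_pow_self p hn0) (dvd_pow_self q hm0)

/-! ### Structure of the minimal configuration -/

/-- The configuration in a minimal exceptional group `G`: the Frattini subgroup is the product
of two minimal normal subgroups `P` and `Q` of `p`-power and `q`-power order. -/
structure IsFrattiniConfiguration (p q : ℕ) {G : Type*} [Group G] (P Q : Subgroup G) : Prop where
  prime_left : p.Prime
  prime_right : q.Prime
  odd_left : Odd p
  odd_right : Odd q
  ne : p ≠ q
  normal_left : P.Normal
  normal_right : Q.Normal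
  isPGroup_left : IsPGroup p P
  isPGroup_right : IsPGroup q Q
  ne_bot_left : P ≠ ⊥
  ne_bot_right : Q ≠ ⊥
  comm_left : ∀ a ∈ P, ∀ b ∈ P, a * b = b * a
  comm_right : ∀ a ∈ Q, ∀ b ∈ Q, a * b = b * a
  sup_eq : P ⊔ Q = frattini G
  le_or_le : ∀ N : Subgroup G, N.Normal → N ≠ ⊥ → P ≤ N ∨ Q ≤ N
  mem_frattini : ∀ g : G, p * q ∣ orderOf g →
    (∀ r : ℕ, r.Prime → r ∣ orderOf g → r = p ∨ r = q) → g ∈ frattini G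
  eq_top : ∀ M : Subgroup G, P ⊔ Q ≤ M → P ⊔ Q ≤ (frattini M).map M.subtype → M = ⊤

namespace IsFrattiniConfiguration

variable {p q : ℕ} {G : Type*} [Group G] {P Q : Subgroup G}

/-- Lets every statement about `P` be used for `Q`. -/
theorem symm (h : IsFrattiniConfiguration p q P Q) : IsFrattiniConfiguration q p Q P where
  prime_left := h.prime_right
  prime_right := h.prime_left
  odd_left := h.odd_right
  odd_right := h.odd_left
  ne := h.ne.symm
  normal_left := h.normal_right
  normal_right := h.normal_left
  isPGroup_left := h.isPGroup_right
  isPGroup_right := h.isPGroup_left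
  ne_bot_left := h.ne_bot_right
  ne_bot_right := h.ne_bot_left
  comm_left := h.comm_right
  comm_right := h.comm_left
  sup_eq := by rw [sup_comm, h.sup_eq]
  le_or_le N hN hN' := (h.le_or_le N hN hN').symm
  mem_frattini g hg hg' := h.mem_frattini g (by rwa [mul_comm]) fun r hr hrg => (hg' r hr hrg).symm
  eq_top M hM := by
    rw [sup_comm] at hM ⊢
    exact h.eq_top M hM

theorem le_left (h : IsFrattiniConfiguration p q P Q) : P ≤ frattini G := h.sup_eq ▸ le_sup_left

theorem le_right (h : IsFrattiniConfiguration p q P Q) : Q ≤ frattini G := h.sup_eq ▸ le_sup_right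

theorem inf_eq_bot (h : IsFrattiniConfiguration p q P Q) : P ⊓ Q = ⊥ :=
  have : Fact p.Prime := ⟨h.prime_left⟩
  have : Fact q.Prime := ⟨h.prime_right⟩
  (IsPGroup.disjoint_of_ne p q h.ne P Q h.isPGroup_left h.isPGroup_right).eq_bot

theorem commute (h : IsFrattiniConfiguration p q P Q) {x y : G} (hx : x ∈ P) (hy : y ∈ Q) :
    Commute x y :=
  Subgroup.commute_of_normal_of_disjoint P Q h.normal_left h.normal_right (disjoint_iff.2 h.inf_eq_bot) x y hx hy

theorem eq_left_of_le (h : IsFrattiniConfiguration p q P Q) {N : Subgroup G} (hN : N.Normal)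
    (hNP : N ≤ P) (hN' : N ≠ ⊥) : N = P := by
  rcases h.le_or_le N hN hN' with h1 | h1
  · exact le_antisymm hNP h1
  · exact absurd (le_bot_iff.1 (h.inf_eq_bot ▸ le_inf (h1.trans hNP) le_rfl)) h.ne_bot_right

/-- If `g ≠ 1`, the order of `x * g` is divisible by `p * q` and by no other primes, so `x * g` is
Frattini, and so is `g`. -/
theorem mem_frattini_of_commute (h : IsFrattiniConfiguration p q P Q) {x g : G} (hx : x ∈ P)
    (hx1 : x ≠ 1) (hg : ∃ n, orderOf g = q ^ n) (hxg : Commute x g) : g ∈ frattini G := by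
  by_cases hg1 : g = 1
  · rw [hg1]
    exact one_mem _
  have : Fact p.Prime := ⟨h.prime_left⟩
  obtain ⟨m, hm⟩ := hg
  obtain ⟨n, hn⟩ := IsPGroup.iff_orderOf.1 h.isPGroup_left ⟨x, hx⟩
  rw [Subgroup.orderOf_mk] at hn
  have h1 : x * g ∈ frattini G := by
    refine h.mem_frattini _ (mul_dvd_orderOf_mul h.prime_left h.prime_right h.ne hxg hx1 hg1
      ⟨n, hn⟩ ⟨m, hm⟩) fun r hr hrd => ?_
    replace hrd := hrd.trans hxg.orderOf_mul_dvd_mul_orderOf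
    rw [hn, hm] at hrd
    rcases hr.dvd_mul.1 hrd with h2 | h2
    · exact Or.inl ((Nat.prime_dvd_prime_iff_eq hr h.prime_left).1 (hr.dvd_of_dvd_pow h2))
    · exact Or.inr ((Nat.prime_dvd_prime_iff_eq hr h.prime_right).1 (hr.dvd_of_dvd_pow h2))
  exact (Subgroup.mul_mem_cancel_left _ (h.le_left hx)).1 h1

theorem frattini_le_centralizer_left (h : IsFrattiniConfiguration p q P Q) :
    frattini G ≤ Subgroup.centralizer P := by
  rw [← h.sup_eq]
  exact sup_le (fun a ha b hb => h.comm_left b hb a ha) fun y hy x hx => h.commute hx hy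

variable [Finite G]

theorem card_left (h : IsFrattiniConfiguration p q P Q) : ∃ n, Nat.card P = p ^ n :=
  have : Fact p.Prime := ⟨h.prime_left⟩
  IsPGroup.iff_card.1 h.isPGroup_left

theorem coprime_card_left (h : IsFrattiniConfiguration p q P Q) {n : ℕ} (hn : ¬ p ∣ n) :
    (Nat.card P).Coprime n := by
  obtain ⟨k, hk⟩ := h.card_left
  rw [hk]
  exact Nat.Coprime.pow_left _ ((Nat.Prime.coprime_iff_not_dvd h.prime_left).2 hn)

theorem not_dvd_relIndex_left (h : IsFrattiniConfiguration p q P Q) {M : Subgroup G}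
    (hM : frattini G ≤ M) (hp : ¬ p ∣ (frattini G).relIndex M) : ¬ p ∣ P.relIndex M := by
  have := h.normal_left
  rw [← Subgroup.relIndex_mul_relIndex P (frattini G) M h.le_left hM, h.prime_left.dvd_mul]
  rintro (h1 | h1)
  · rw [← h.sup_eq, sup_comm, Subgroup.relIndex_sup_right] at h1
    obtain ⟨k, hk⟩ := h.symm.card_left
    have h2 := h1.trans (hk ▸ (P.subgroupOf Q).index_dvd_card)
    exact h.ne ((Nat.prime_dvd_prime_iff_eq h.prime_left h.prime_right).1
      (h.prime_left.dvd_of_dvd_pow h2))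
  · exact hp h1

/-- `P` is a Hall subgroup of `M`, so it has a normal complement there, and normal subgroups with
trivial intersection commute. -/
theorem le_centralizer_left (h : IsFrattiniConfiguration p q P Q) {M : Subgroup G} [M.Normal]
    (hM : frattini G ≤ M) (hp : ¬ p ∣ (frattini G).relIndex M) :
    M ≤ Subgroup.centralizer P := by
  have := h.normal_left
  obtain ⟨K, hK, hsup, hinf⟩ := exists_normal_complement P M h.comm_left h.le_left
    (h.le_left.trans hM) (h.coprime_card_left (h.not_dvd_relIndex_left hM hp))
  rw [← hsup]
  refine sup_le (fun a ha b hb => h.comm_left b hb a ha) fun k hk x hx => ?_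
  exact Subgroup.commute_of_normal_of_disjoint P K ‹_› hK (disjoint_iff.2 hinf) x k hx hk

theorem not_dvd_relIndex_centralizer (h : IsFrattiniConfiguration p q P Q) :
    ¬ q ∣ (frattini G).relIndex (Subgroup.centralizer P) := by
  intro hdvd
  obtain ⟨g, hg, hgF, hgo⟩ := exists_mem_notMem_of_dvd_relIndex h.prime_right _ _ hdvd
  obtain ⟨⟨x, hx⟩, hx1⟩ := Subgroup.ne_bot_iff_exists_ne_one.1 h.ne_bot_left
  exact hgF (h.mem_frattini_of_commute hx (by simpa using hx1) hgo (hg x hx))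

/-- By `le_centralizer_left`, applied on both sides, `P` and `Q` have the same centralizer. The
abelian group `frattini G` is a Hall subgroup of it; a normal complement contains neither `P` nor
`Q`, hence is trivial. -/
theorem centralizer_left (h : IsFrattiniConfiguration p q P Q) :
    Subgroup.centralizer P = frattini G := by
  have := h.normal_left
  have := h.normal_right
  have hC : (Subgroup.centralizer (P : Set G)) = Subgroup.centralizer Q :=
    le_antisymm
      (h.symm.le_centralizer_left h.frattini_le_centralizer_left h.not_dvd_relIndex_centralizer)
      (h.le_centralizer_left h.symm.frattini_le_centralizer_left
        h.symm.not_dvd_relIndex_centralizer)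
  have hq := h.not_dvd_relIndex_centralizer
  have hp := h.symm.not_dvd_relIndex_centralizer
  rw [← hC] at hp
  have hcard : Nat.card (frattini G) ∣ Nat.card P * Nat.card Q := by
    rw [← h.sup_eq, ← Subgroup.relIndex_bot_left, ← Subgroup.relIndex_mul_relIndex ⊥ P _ bot_le
      le_sup_left, Subgroup.relIndex_bot_left, sup_comm, Subgroup.relIndex_sup_right]
    exact mul_dvd_mul_left _ (P.subgroupOf Q).index_dvd_card
  have hcop : (Nat.card (frattini G)).Coprime
      ((frattini G).relIndex (Subgroup.centralizer P)) :=
    Nat.Coprime.of_dvd_left hcard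
      (Nat.Coprime.mul_left (h.coprime_card_left hp) (h.symm.coprime_card_left hq))
  obtain ⟨K, hK, hsup, hinf⟩ := exists_normal_complement (frattini G) (Subgroup.centralizer P)
    (fun a ha b hb => by
      have h1 : frattini G ≤ Subgroup.centralizer (frattini G) := by
        conv_lhs => rw [← h.sup_eq]
        refine sup_le (fun x hx y hy => ?_) (fun x hx y hy => ?_)
        · exact (h.frattini_le_centralizer_left hy x hx).symm
        · exact (h.symm.frattini_le_centralizer_left hy x hx).symm
      exact h1 hb a ha) le_rfl h.frattini_le_centralizer_left hcop
  have hKbot : K = ⊥ := by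
    by_contra hne
    rcases h.le_or_le K hK hne with h1 | h1
    · exact h.ne_bot_left (le_bot_iff.1 (hinf ▸ le_inf h.le_left h1))
    · exact h.ne_bot_right (le_bot_iff.1 (hinf ▸ le_inf h.le_right h1))
  rw [← hsup, hKbot, sup_bot_eq]

theorem dvd_relIndex_left (h : IsFrattiniConfiguration p q P Q) {M : Subgroup G} [M.Normal]
    (hM : frattini G < M) : p ∣ (frattini G).relIndex M := by
  by_contra hp
  exact absurd (h.centralizer_left ▸ h.le_centralizer_left hM.le hp) (not_le_of_gt hM)

/-- Otherwise `P` meets the Frattini subgroup of `M` trivially, by minimality of `P`, and so has a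
complement in `M`. By Gaschütz it has one in `G`, impossible for a nontrivial subgroup of `frattini
G`. -/
theorem le_map_frattini_left (h : IsFrattiniConfiguration p q P Q) {M : Subgroup G} [M.Normal]
    (hM : frattini G ≤ M) (hp : ¬ p ∣ M.index) : P ≤ (frattini M).map M.subtype := by
  have := h.normal_left
  by_contra hle
  have hPM := h.le_left.trans hM
  have hinf : P ⊓ (frattini M).map M.subtype = ⊥ := by
    by_contra hne
    have h1 := h.eq_left_of_le (N := P ⊓ (frattini M).map M.subtype) inferInstance inf_le_left hne
    exact hle (inf_eq_left.1 h1)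
  have hmap : (P.subgroupOf M).map M.subtype = P := Subgroup.map_subgroupOf_eq_of_le hPM
  obtain ⟨L, hsupL, hinfL⟩ := exists_complement_of_inf_frattini_eq_bot (P.subgroupOf M)
    (fun a ha b hb => Subtype.ext (h.comm_left a ha b hb)) (by
      rw [← Subgroup.map_eq_bot_iff_of_injective _ M.subtype_injective,
        Subgroup.map_inf _ _ _ M.subtype_injective, hmap, hinf])
  obtain ⟨K, hsup, hinf⟩ := exists_complement_of_coprime_index P M (L.map M.subtype) h.comm_left
    (by rw [← hmap, ← Subgroup.map_sup, hsupL, ← MonoidHom.range_eq_map, Subgroup.range_subtype])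
    (by rw [← hmap, ← Subgroup.map_inf _ _ _ M.subtype_injective, hinfL, Subgroup.map_bot])
    (h.coprime_card_left hp)
  rw [eq_top_of_le_frattini_of_sup_eq_top h.le_left hsup, inf_top_eq] at hinf
  exact h.ne_bot_left hinf

theorem eq_top_of_not_dvd_index (h : IsFrattiniConfiguration p q P Q) {M : Subgroup G} [M.Normal]
    (hM : frattini G ≤ M) (hp : ¬ p ∣ M.index) (hq : ¬ q ∣ M.index) : M = ⊤ :=
  h.eq_top M (h.sup_eq ▸ hM)
    (sup_le (h.le_map_frattini_left hM hp) (h.symm.le_map_frattini_left hM hq))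

end IsFrattiniConfiguration

/-! ### From a minimal exceptional group to the configuration -/

theorem exists_normal_sylow_of_frattini {G : Type*} [Group G] [Finite G] {r : ℕ} (hr : r.Prime) :
    ∃ N : Subgroup G, N.Normal ∧ N ≤ frattini G ∧ IsPGroup r N ∧
      ∀ x ∈ frattini G, (∃ n, orderOf x = r ^ n) → x ∈ N := by
  have : Fact r.Prime := ⟨hr⟩
  obtain ⟨R⟩ : Nonempty (Sylow r (frattini G)) := inferInstance
  have hnil : Group.IsNilpotent (frattini G) := frattini_nilpotent
  have htfae := (Group.isNilpotent_of_finite_tfae (G := frattini G)).out 0 3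
  have hRn : (R : Subgroup (frattini G)).Normal := htfae.1 hnil r ⟨hr⟩ R
  have hRc : (R : Subgroup (frattini G)).Characteristic := R.characteristic_of_normal hRn
  refine ⟨(R : Subgroup (frattini G)).map (frattini G).subtype, inferInstance,
    Subgroup.map_subtype_le _, R.isPGroup'.map _, fun x hx ⟨n, hn⟩ => ?_⟩
  have hp : IsPGroup r (Subgroup.zpowers (⟨x, hx⟩ : frattini G)) := by
    refine IsPGroup.of_card (n := n) ?_
    rw [Nat.card_zpowers, Subgroup.orderOf_mk, hn]
  obtain ⟨R', hR'⟩ := hp.exists_le_sylow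
  have := R.unique_of_normal hRn
  rw [Subsingleton.elim R' R] at hR'
  exact ⟨⟨x, hx⟩, hR' (Subgroup.mem_zpowers _), rfl⟩

/-- The centre of a nontrivial `p`-group is nontrivial and characteristic, so by minimality it is
all of `P`. -/
theorem IsPGroup.comm_of_minimal {G : Type*} [Group G] [Finite G] {p : ℕ} (hp : p.Prime)
    {P : Subgroup G} [P.Normal] (hP : IsPGroup p P) (hP1 : P ≠ ⊥)
    (hmin : ∀ N : Subgroup G, N.Normal → N ≠ ⊥ → N ≤ P → P ≤ N) :
    ∀ a ∈ P, ∀ b ∈ P, a * b = b * a := by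
  have : Fact p.Prime := ⟨hp⟩
  have : Nontrivial P := (Subgroup.nontrivial_iff_ne_bot P).2 hP1
  have hZ : Nontrivial (Subgroup.center P) := hP.center_nontrivial
  have hle := hmin ((Subgroup.center P).map P.subtype) inferInstance
    (by
      rw [Ne, Subgroup.map_eq_bot_iff_of_injective _ P.subtype_injective]
      exact (Subgroup.nontrivial_iff_ne_bot _).1 hZ)
    (Subgroup.map_subtype_le _)
  intro a ha b hb
  obtain ⟨z, hz, rfl⟩ := hle ha
  exact (congrArg Subtype.val (Subgroup.mem_center_iff.1 hz ⟨b, hb⟩)).symm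

theorem IsExceptional.mem_frattini {p q : ℕ} {G : Type u} [Group G] (hG : IsExceptional p q G)
    {g : G} (hg : p * q ∣ orderOf g)
    (hg' : ∀ r : ℕ, r.Prime → r ∣ orderOf g → r = p ∨ r = q) : g ∈ frattini G := by
  by_contra hgF
  have : g ∈ OmegaStarStar p q G := ⟨⟨hg, hgF⟩, hg'⟩
  rw [hG.2] at this
  exact this

/-- The quotient is too small to be exceptional, so otherwise it has a non-Frattini element of the
forbidden kind. A lift with the same prime divisors lies in `frattini G`, whose image is Frattini.
-/
theorem IsMinimalExceptional.omega_quotient_eq_empty {p q : ℕ} {G : Type u} [Group G] [Finite G]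
    (hG : IsMinimalExceptional p q G) (N : Subgroup G) [N.Normal] (hN : N ≠ ⊥) :
    Omega p q (G ⧸ N) = ∅ := by
  by_contra hne
  rw [← Ne, ← Set.nonempty_iff_ne_empty] at hne
  have h1 : OmegaStarStar p q (G ⧸ N) ≠ ∅ := by
    intro h2
    have h3 := hG.2 (G ⧸ N) ⟨hne, h2⟩
    have h4 := N.card_eq_card_quotient_mul_card_subgroup
    have h5 : 1 < Nat.card N := N.one_lt_card_iff_ne_bot.2 hN
    have h6 : 0 < Nat.card (G ⧸ N) := Nat.card_pos
    nlinarith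
  obtain ⟨y, ⟨hy1, hy2⟩, hy3⟩ := Set.nonempty_iff_ne_empty.2 h1
  obtain ⟨x, rfl, hx⟩ := exists_lift_primeFactors (QuotientGroup.mk' N)
    (QuotientGroup.mk'_surjective N) y
  have hxF := hG.1.mem_frattini (hy1.trans (orderOf_map_dvd _ x))
    fun r hr hrx => hy3 r hr (hx r hr hrx)
  exact hy2 (frattini_le_comap_frattini_of_surjective (QuotientGroup.mk'_surjective N) hxF)

theorem IsMinimalExceptional.exists_isFrattiniConfiguration {p q : ℕ} (hp : p.Prime)
    (hq : q.Prime) (hp_odd : Odd p) (hq_odd : Odd q) (hpq : p ≠ q) {G : Type u} [Group G]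
    [Finite G] (hG : IsMinimalExceptional p q G) :
    ∃ P Q : Subgroup G, IsFrattiniConfiguration p q P Q := by
  have : Fact p.Prime := ⟨hp⟩
  have : Fact q.Prime := ⟨hq⟩
  obtain ⟨P, hPn, hPF, hP, hPmem⟩ := exists_normal_sylow_of_frattini (G := G) hp
  obtain ⟨Q, hQn, hQF, hQ, hQmem⟩ := exists_normal_sylow_of_frattini (G := G) hq
  obtain ⟨g, hgo⟩ : ∃ g : G, orderOf g = p * q := by
    obtain ⟨x, hx⟩ := hG.1.1
    obtain ⟨k, hk⟩ : p * q ∣ orderOf x := hx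
    refine ⟨x ^ k, ?_⟩
    have hk0 : k ≠ 0 := by
      rintro rfl
      exact (orderOf_pos x).ne' (by simpa using hk)
    rw [orderOf_pow_of_dvd hk0 (hk ▸ dvd_mul_left _ _), hk, Nat.mul_div_cancel _ (by omega)]
  have hgprime : ∀ r : ℕ, r.Prime → r ∣ orderOf g → r = p ∨ r = q := by
    intro r hr hrg
    rw [hgo] at hrg
    exact (hr.dvd_mul.1 hrg).imp (Nat.prime_dvd_prime_iff_eq hr hp).1
      (Nat.prime_dvd_prime_iff_eq hr hq).1
  have hgF : g ∈ frattini G := hG.1.mem_frattini hgo.symm.dvd hgprime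
  have ha : orderOf (g ^ q) = p := by
    rw [orderOf_pow_of_dvd hq.ne_zero (hgo ▸ dvd_mul_left _ _), hgo, Nat.mul_div_cancel _ hq.pos]
  have hb : orderOf (g ^ p) = q := by
    rw [orderOf_pow_of_dvd hp.ne_zero (hgo ▸ dvd_mul_right _ _), hgo,
      Nat.mul_div_cancel_left _ hp.pos]
  have hP1 : P ≠ ⊥ := by
    intro h
    have h1 := hPmem _ (pow_mem hgF q) ⟨1, by rw [ha, pow_one]⟩
    rw [h, Subgroup.mem_bot] at h1
    rw [h1, orderOf_one] at ha
    exact hp.one_lt.ne ha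
  have hQ1 : Q ≠ ⊥ := by
    intro h
    have h1 := hQmem _ (pow_mem hgF p) ⟨1, by rw [hb, pow_one]⟩
    rw [h, Subgroup.mem_bot] at h1
    rw [h1, orderOf_one] at hb
    exact hq.one_lt.ne hb
  have hdisj : Disjoint P Q := IsPGroup.disjoint_of_ne p q hpq P Q hP hQ
  have hmin : ∀ N : Subgroup G, N.Normal → N ≠ ⊥ → P ≤ N ∨ Q ≤ N := by
    intro N hN hN1
    -- Elements of `P` and `Q` outside `N` commute, so their product maps to an element of order
    -- divisible by `p * q`.
    by_contra! hcon
    obtain ⟨⟨a, haP, haN⟩, ⟨b, hbQ, hbN⟩⟩ := hcon.imp SetLike.not_le_iff_exists.1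
      SetLike.not_le_iff_exists.1
    have hab : Commute a b := Subgroup.commute_of_normal_of_disjoint P Q hPn hQn hdisj a b haP hbQ
    have h1 : ((a * b : G) : G ⧸ N) ∈ Omega p q (G ⧸ N) := by
      refine mul_dvd_orderOf_mul hp hq hpq (hab.map (QuotientGroup.mk' N))
        (fun h => haN ((QuotientGroup.eq_one_iff a).1 h))
        (fun h => hbN ((QuotientGroup.eq_one_iff b).1 h)) ?_ ?_
      · obtain ⟨n, hn⟩ := IsPGroup.iff_orderOf.1 hP ⟨a, haP⟩
        rw [Subgroup.orderOf_mk] at hn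
        obtain ⟨m, -, hm⟩ := (Nat.dvd_prime_pow hp).1
          (hn ▸ orderOf_map_dvd (QuotientGroup.mk' N) a)
        exact ⟨m, hm⟩
      · obtain ⟨n, hn⟩ := IsPGroup.iff_orderOf.1 hQ ⟨b, hbQ⟩
        rw [Subgroup.orderOf_mk] at hn
        obtain ⟨m, -, hm⟩ := (Nat.dvd_prime_pow hq).1
          (hn ▸ orderOf_map_dvd (QuotientGroup.mk' N) b)
        exact ⟨m, hm⟩
    rw [hG.omega_quotient_eq_empty N hN1] at h1
    exact h1
  have hnotle : ¬ Q ≤ P := fun h => hQ1 (le_bot_iff.1 (hdisj h le_rfl))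
  have hnotle' : ¬ P ≤ Q := fun h => hP1 (le_bot_iff.1 (hdisj le_rfl h))
  have hsup : P ⊔ Q = frattini G := by
    refine le_antisymm (sup_le hPF hQF) ?_
    by_contra hle
    obtain ⟨r, hr, hrd⟩ := Nat.exists_prime_and_dvd (mt Subgroup.relIndex_eq_one.1 hle)
    have : Fact r.Prime := ⟨hr⟩
    obtain ⟨x, hxF, hx, hxo⟩ := exists_mem_notMem_of_dvd_relIndex hr _ _ hrd
    apply hx
    by_cases hrp : r = p
    · subst hrp
      exact Subgroup.mem_sup_left (hPmem x hxF hxo)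
    by_cases hrq : r = q
    · subst hrq
      exact Subgroup.mem_sup_right (hQmem x hxF hxo)
    -- A nontrivial normal `r`-subgroup, for a third prime `r`, would contain neither `P` nor `Q`.
    obtain ⟨N, hNn, -, hN, hNmem⟩ := exists_normal_sylow_of_frattini (G := G) hr
    have hN1 : N = ⊥ := by
      by_contra hN1
      rcases hmin N hNn hN1 with h | h
      · exact hP1 (le_bot_iff.1 (IsPGroup.disjoint_of_ne p r (Ne.symm hrp) P N hP hN le_rfl h))
      · exact hQ1 (le_bot_iff.1 (IsPGroup.disjoint_of_ne q r (Ne.symm hrq) Q N hQ hN le_rfl h))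
    have := hNmem x hxF hxo
    rw [hN1, Subgroup.mem_bot] at this
    rw [this]
    exact one_mem _
  refine ⟨P, Q, hp, hq, hp_odd, hq_odd, hpq, hPn, hQn, hP, hQ, hP1, hQ1,
    hP.comm_of_minimal hp hP1 fun N hN hN1 hNP =>
      (hmin N hN hN1).resolve_right fun h => hnotle (h.trans hNP),
    hQ.comm_of_minimal hq hQ1 fun N hN hN1 hNQ =>
      (hmin N hN hN1).resolve_left fun h => hnotle' (h.trans hNQ),
    hsup, hmin, fun _ => hG.1.mem_frattini, fun M hM hM' => ?_⟩
  rw [hsup] at hM hM'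
  -- `M` is itself exceptional: it contains `g`, and its forbidden elements lie in `frattini G`,
  -- hence in the Frattini subgroup of `M`.
  apply Subgroup.eq_top_of_le_card
  apply hG.2 M
  refine ⟨⟨⟨g, hM hgF⟩, ?_⟩, ?_⟩
  · change p * q ∣ orderOf _
    rw [Subgroup.orderOf_mk, hgo]
  · rw [Set.eq_empty_iff_forall_notMem]
    rintro ⟨y, hyM⟩ ⟨⟨hy1, hy2⟩, hy3⟩
    change p * q ∣ orderOf _ at hy1
    rw [Subgroup.orderOf_mk] at hy1
    simp only [Subgroup.orderOf_mk] at hy3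
    obtain ⟨z, hz, rfl⟩ := hM' (hG.1.mem_frattini hy1 hy3)
    exact hy2 hz

/-! ### Conjugation modules and the splitting criterion -/

/-- The embedding `ι` identifies the `S`-module `V` with the normal subgroup `A` of `G`, on which
`G` acts by conjugation through `π : G →* S`. -/
structure IsConjugationModule {G S V : Type*} [Group G] [Group S] [AddCommGroup V]
    (π : G →* S) (A : Subgroup G) (ρ : Representation ℤ S V) (ι : Multiplicative V →* G) :
    Prop where
  injective : Function.Injective ι
  range_eq : ι.range = A
  conj_eq : ∀ g v, g * ι (Multiplicative.ofAdd v) * g⁻¹ = ι (Multiplicative.ofAdd (ρ (π g) v))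

/-- A normal abelian subgroup `A` of `G` on which the kernel of `π : G →* S` acts trivially
is an `S`-module. -/
theorem exists_representation_of_normal {G : Type*} [Group G] [Finite G] {S : Type} [Group S]
    (π : G →* S) (hπ : Function.Surjective π) (A : Subgroup G) [A.Normal]
    (hA : ∀ a ∈ A, ∀ b ∈ A, a * b = b * a) (hker : π.ker ≤ Subgroup.centralizer A) :
    ∃ (V : Type) (_ : AddCommGroup V) (ρ : Representation ℤ S V) (ι : Multiplicative V →* G),
      IsConjugationModule π A ρ ι := by
  let _ : CommGroup A :=
    { (inferInstance : Group A) with mul_comm := fun a b => Subtype.ext (hA a a.2 b b.2) }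
  -- `A` is finite, so it has a copy in `Type`, whatever the universe of `G`.
  let V := Shrink.{0} (Additive A)
  let e : V ≃+ Additive A := Shrink.addEquiv
  let ι : Multiplicative V →* G := MonoidHom.mk' (fun v => ((e v.toAdd).toMul : A)) fun v w => by
    simp
  have hι : Function.Injective ι := fun v w h => by
    have h1 : (e v.toAdd).toMul = (e w.toAdd).toMul := Subtype.ext h
    simpa using h1
  have hrange : ∀ g, g ∈ A ↔ ∃ v, ι (Multiplicative.ofAdd v) = g := by
    intro g
    constructor
    · intro hg
      exact ⟨e.symm (Additive.ofMul ⟨g, hg⟩), by simp [ι]⟩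
    · rintro ⟨v, rfl⟩
      exact SetLike.coe_mem _
  have hact : ∀ (s : S) (v : V), ∃ w : V, ∀ g, π g = s →
      -- One `w` serves all lifts of `s`, since the kernel of `π` centralizes `A`.
      g * ι (Multiplicative.ofAdd v) * g⁻¹ = ι (Multiplicative.ofAdd w) := by
    intro s v
    obtain ⟨g, rfl⟩ := hπ s
    have hv := (hrange _).2 ⟨v, rfl⟩
    obtain ⟨w, hw⟩ := (hrange _).1 (‹A.Normal›.conj_mem _ hv g)
    refine ⟨w, fun g' hg' => ?_⟩
    have h1 : g⁻¹ * g' ∈ π.ker := by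
      rw [MonoidHom.mem_ker, map_mul, map_inv, hg', inv_mul_cancel]
    have h2 := hker h1 _ hv
    rw [hw]
    calc g' * ι (Multiplicative.ofAdd v) * g'⁻¹
        = g * ((g⁻¹ * g') * ι (Multiplicative.ofAdd v)) * (g⁻¹ * g')⁻¹ * g⁻¹ := by group
      _ = g * ι (Multiplicative.ofAdd v) * g⁻¹ := by rw [← h2]; group
  choose r hr using hact
  have hinj : ∀ v w : V, ι (Multiplicative.ofAdd v) = ι (Multiplicative.ofAdd w) → v = w :=
    fun v w h => Multiplicative.ofAdd.injective (hι h)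
  have hadd : ∀ s v w, r s (v + w) = r s v + r s w := by
    intro s v w
    obtain ⟨g, hg⟩ := hπ s
    apply hinj
    rw [← hr s _ g hg, ofAdd_add, ofAdd_add, map_mul, map_mul, ← hr s _ g hg, ← hr s _ g hg]
    group
  let ρ : Representation ℤ S V :=
    { toFun := fun s => (AddMonoidHom.mk' (r s) (hadd s)).toIntLinearMap
      map_one' := by
        refine LinearMap.ext fun v => hinj _ _ ?_
        exact (hr 1 v 1 (map_one π)).symm.trans (by simp)
      map_mul' := by
        intro s t
        obtain ⟨g, rfl⟩ := hπ s
        obtain ⟨k, rfl⟩ := hπ t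
        refine LinearMap.ext fun v => hinj _ _ ?_
        refine (hr _ v (g * k) (map_mul π g k)).symm.trans ?_
        refine Eq.trans ?_ (hr _ _ g rfl)
        change _ = g * ι (Multiplicative.ofAdd (r (π k) v)) * g⁻¹
        rw [← hr _ v k rfl]
        group }
  refine ⟨V, inferInstance, ρ, ι, hι, ?_, fun g v => hr _ v g rfl⟩
  ext g
  exact (hrange g).symm

namespace IsConjugationModule

variable {G S V : Type*} [Group G] [Group S] [AddCommGroup V] {π : G →* S} {A : Subgroup G}
  {ρ : Representation ℤ S V} {ι : Multiplicative V →* G}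

theorem mem (h : IsConjugationModule π A ρ ι) (v : V) : ι (Multiplicative.ofAdd v) ∈ A :=
  h.range_eq ▸ ⟨_, rfl⟩

theorem exists_eq (h : IsConjugationModule π A ρ ι) {g : G} (hg : g ∈ A) :
    ∃ v, ι (Multiplicative.ofAdd v) = g := by
  rw [← h.range_eq] at hg
  obtain ⟨v, rfl⟩ := hg
  exact ⟨v.toAdd, rfl⟩

theorem eq_of_map_eq (h : IsConjugationModule π A ρ ι) {v w : V}
    (hvw : ι (Multiplicative.ofAdd v) = ι (Multiplicative.ofAdd w)) : v = w :=
  Multiplicative.ofAdd.injective (h.injective hvw)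

theorem eq_zero (h : IsConjugationModule π A ρ ι) {v : V}
    (hv : ι (Multiplicative.ofAdd v) = 1) : v = 0 :=
  h.eq_of_map_eq (by rw [hv, ofAdd_zero, map_one])

theorem commute_of_apply_eq (h : IsConjugationModule π A ρ ι) {g : G} {v : V}
    (hv : ρ (π g) v = v) : Commute (ι (Multiplicative.ofAdd v)) g := by
  have h1 := h.conj_eq g v
  rw [hv] at h1
  exact (mul_inv_eq_iff_eq_mul.1 h1).symm

theorem card_eq (h : IsConjugationModule π A ρ ι) : Nat.card V = Nat.card A := by
  rw [← h.range_eq]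
  exact (Nat.card_congr Multiplicative.ofAdd).trans
    (Nat.card_congr (MonoidHom.ofInjective h.injective).toEquiv)

theorem nontrivial (h : IsConjugationModule π A ρ ι) (hA : A ≠ ⊥) : Nontrivial V := by
  obtain ⟨⟨x, hx⟩, hx1⟩ := Subgroup.ne_bot_iff_exists_ne_one.1 hA
  obtain ⟨v, rfl⟩ := h.exists_eq hx
  refine ⟨v, 0, fun hv => hx1 ?_⟩
  simp [hv]

/-- Subrepresentations correspond to normal subgroups of `G` inside `A`. -/
theorem isSimpleOrder (h : IsConjugationModule π A ρ ι) (hA : A ≠ ⊥)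
    (hmin : ∀ N : Subgroup G, N.Normal → N ≤ A → N ≠ ⊥ → N = A) :
    IsSimpleOrder (Subrepresentation ρ) where
  exists_pair_ne := by
    have := h.nontrivial hA
    obtain ⟨v, hv⟩ := exists_ne (0 : V)
    refine ⟨⊥, ⊤, fun heq => hv ?_⟩
    have h1 : v ∈ (⊤ : Subrepresentation ρ).toSubmodule := Submodule.mem_top
    rw [← heq] at h1
    exact (Submodule.mem_bot ℤ).1 h1
  eq_bot_or_eq_top U := by
    let N : Subgroup G := (AddSubgroup.toSubgroup U.toSubmodule.toAddSubgroup).map ι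
    have hmem : ∀ v, ι (Multiplicative.ofAdd v) ∈ N ↔ v ∈ U.toSubmodule := by
      intro v
      constructor
      · rintro ⟨w, hw, hwv⟩
        obtain rfl := h.injective hwv
        exact hw
      · exact fun hv => ⟨Multiplicative.ofAdd v, hv, rfl⟩
    have hN : N.Normal := by
      refine ⟨?_⟩
      rintro _ ⟨v, hv, rfl⟩ g
      have h1 := h.conj_eq g v.toAdd
      rw [ofAdd_toAdd] at h1
      rw [h1, hmem]
      exact U.apply_mem_toSubmodule _ hv
    have hNA : N ≤ A := by
      rintro _ ⟨v, hv, rfl⟩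
      exact h.mem v.toAdd
    by_cases hN1 : N = ⊥
    · left
      apply Subrepresentation.toSubmodule_injective
      refine (Submodule.eq_bot_iff _).2 fun v hv => ?_
      have := (hmem v).2 hv
      rw [hN1, Subgroup.mem_bot] at this
      exact h.eq_zero this
    · right
      apply Subrepresentation.toSubmodule_injective
      refine Submodule.eq_top_iff'.2 fun v => ?_
      rw [← hmem, hmin N hN hNA hN1]
      exact h.mem v

end IsConjugationModule

/-- If the second cohomology of a conjugation module `A` vanishes and `ker π = A × B`,
then `A` has a complement in `G` modulo `B`. -/
theorem IsConjugationModule.exists_sup_eq_top {G : Type*} {S V : Type} [Group G] [Group S]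
    [AddCommGroup V] {π : G →* S} {A B : Subgroup G} {ρ : Representation ℤ S V}
    {ι : Multiplicative V →* G} (h : IsConjugationModule π A ρ ι) (hπ : Function.Surjective π)
    [B.Normal] (hsup : A ⊔ B = π.ker) (hinf : A ⊓ B = ⊥)
    (hH : Subsingleton (groupCohomology.H2 (Rep.of ρ))) :
    ∃ X : Subgroup G, A ⊔ X = ⊤ ∧ A ⊓ X = ⊥ := by
  have hBker : B ≤ π.ker := hsup ▸ le_sup_right
  let mk : G →* G ⧸ B := QuotientGroup.mk' B
  let j : V → G ⧸ B := fun v => mk (ι (Multiplicative.ofAdd v))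
  -- Through `j`, the group `G ⧸ B` is an extension of `S` by `V`; `c` below is its factor set for
  -- the section `σ`.
  have hj_add : ∀ v w, j (v + w) = j v * j w := fun v w => by simp [j, ofAdd_add]
  have hj_inj : ∀ v w, j v = j w → v = w := by
    intro v w hvw
    have h1 : (ι (Multiplicative.ofAdd v))⁻¹ * ι (Multiplicative.ofAdd w) ∈ A ⊓ B :=
      ⟨A.mul_mem (A.inv_mem (h.mem v)) (h.mem w), QuotientGroup.eq.1 hvw⟩
    rw [hinf, Subgroup.mem_bot] at h1
    exact h.eq_of_map_eq (inv_mul_eq_one.1 h1)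
  have hj_comm : ∀ v w, j v * j w = j w * j v := fun v w => by
    rw [← hj_add, add_comm, hj_add]
  choose σ hσ using hπ
  have hj_conj : ∀ s v, j (ρ s v) = mk (σ s) * j v * (mk (σ s))⁻¹ := fun s v => by
    have h1 := h.conj_eq (σ s) v
    rw [hσ] at h1
    simp only [j, ← h1, map_mul, map_inv]
  have hc : ∀ s t, ∃ v, mk (σ s) * mk (σ t) = j v * mk (σ (s * t)) := by
    intro s t
    have h1 : σ s * σ t * (σ (s * t))⁻¹ ∈ A ⊔ B := by
      rw [hsup, MonoidHom.mem_ker]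
      simp [hσ]
    obtain ⟨a, ha, b, hb, hab⟩ := Subgroup.mem_sup_of_normal_right.1 h1
    obtain ⟨v, rfl⟩ := h.exists_eq ha
    refine ⟨v, ?_⟩
    have h2 := congrArg mk hab
    have h3 : mk b = 1 := (QuotientGroup.eq_one_iff b).2 hb
    simp only [map_mul, map_inv, h3, mul_one] at h2
    rw [eq_comm, mul_inv_eq_iff_eq_mul] at h2
    exact h2
  choose c hc using hc
  let f : S × S → V := fun x => c x.1 x.2
  have hf : f ∈ groupCohomology.cocycles₂ (Rep.of ρ) := by
    rw [groupCohomology.mem_cocycles₂_iff]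
    intro s t r
    change c (s * t) r + c s t = ρ s (c t r) + c s (t * r)
    apply hj_inj
    rw [hj_add, hj_add, hj_comm, hj_conj]
    apply mul_right_cancel (b := mk (σ (s * t * r)))
    calc j (c s t) * j (c (s * t) r) * mk (σ (s * t * r))
        = mk (σ s) * mk (σ t) * mk (σ r) := by rw [mul_assoc, ← hc, ← mul_assoc, ← hc]
      _ = mk (σ s) * (j (c t r) * mk (σ (t * r))) := by rw [← hc, mul_assoc]
      _ = mk (σ s) * j (c t r) * (mk (σ s))⁻¹ * (mk (σ s) * mk (σ (t * r))) := by group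
      _ = _ := by rw [hc, ← mul_assoc, mul_assoc s t r]
  have hf' : f ∈ groupCohomology.coboundaries₂ (Rep.of ρ) :=
    (groupCohomology.H2π_eq_zero_iff (⟨f, hf⟩ : groupCohomology.cocycles₂ (Rep.of ρ))).1
      (Subsingleton.elim _ _)
  obtain ⟨x, hx⟩ := hf'
  have hx' : ∀ s t, ρ s (x t) + x s = c s t + x (s * t) := by
    intro s t
    have h1 : ρ s (x t) - x (s * t) + x s = c s t := congrFun hx (s, t)
    rw [← h1]
    abel
  -- Dividing the section by the cochain `x` gives a splitting; the preimage of its range is the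
  -- complement.
  let τ : S →* G ⧸ B := MonoidHom.mk' (fun s => (j (x s))⁻¹ * mk (σ s)) fun s t => by
    have h1 := congrArg j (hx' s t)
    rw [hj_add, hj_add, hj_conj] at h1
    have h2 : mk (σ (s * t)) = (j (c s t))⁻¹ * (mk (σ s) * mk (σ t)) := by rw [hc]; group
    have h3 : (j (x (s * t)))⁻¹ * (j (c s t))⁻¹ = (j (c s t) * j (x (s * t)))⁻¹ := by group
    rw [h2, ← mul_assoc, h3, ← h1]
    group
  have hτ : ∀ s, τ s = (j (x s))⁻¹ * mk (σ s) := fun s => rfl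
  refine ⟨τ.range.comap mk, ?_, ?_⟩
  · have hB : B ≤ τ.range.comap mk := fun b hb => by
      rw [Subgroup.mem_comap, show mk b = 1 from (QuotientGroup.eq_one_iff b).2 hb]
      exact one_mem _
    rw [eq_top_iff]
    intro g _
    let t := (ι (Multiplicative.ofAdd (x (π g))))⁻¹ * σ (π g)
    have ht : t ∈ A ⊔ τ.range.comap mk := Subgroup.mem_sup_right ⟨π g, by simp [hτ, t, j]⟩
    have hgt : g * (σ (π g))⁻¹ ∈ A ⊔ B := by
      rw [hsup, MonoidHom.mem_ker, map_mul, map_inv, hσ, mul_inv_cancel]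
    have h1 := mul_mem (mul_mem (sup_le_sup_left hB A hgt) (Subgroup.mem_sup_left (h.mem (x (π g))))) ht
    simpa [t, mul_assoc] using h1
  · rw [eq_bot_iff]
    rintro a ⟨ha, s, hs⟩
    have hAker : A ≤ π.ker := hsup ▸ le_sup_left
    let π' : G ⧸ B →* S := QuotientGroup.lift B π hBker
    have hπ'j : ∀ v, π' (j v) = 1 := fun v => hAker (h.mem v)
    have hπ'mk : ∀ g, π' (mk g) = π g := fun g => rfl
    have h1 := congrArg π' hs
    rw [hτ, map_mul, map_inv, hπ'j, hπ'mk, hπ'mk, hσ, hAker ha] at h1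
    have h2 : s = 1 := by simpa using h1
    rw [h2, map_one] at hs
    rw [← hinf]
    exact ⟨ha, (QuotientGroup.eq_one_iff a).1 hs.symm⟩

/-! ### The Frattini quotient gives a Frattini triple -/

namespace IsFrattiniConfiguration

variable {p q : ℕ} {G : Type*} [Group G] [Finite G] {P Q : Subgroup G}
  {S : Type*} [Group S] {π : G →* S}

theorem omega_eq_empty (h : IsFrattiniConfiguration p q P Q) (hπ : Function.Surjective π)
    (hker : π.ker = frattini G) : Omega p q S = ∅ := by
  rw [Set.eq_empty_iff_forall_notMem]
  intro s hs
  change p * q ∣ orderOf s at hs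
  have hpos : orderOf s ≠ 0 := by
    have : Finite S := Finite.of_surjective π hπ
    exact (orderOf_pos s).ne'
  obtain ⟨k, hk⟩ := hs
  have hk0 : k ≠ 0 := by
    rintro rfl
    exact hpos (by simpa using hk)
  have ho : orderOf (s ^ k) = p * q := by
    rw [orderOf_pow_of_dvd hk0 (hk ▸ dvd_mul_left _ _), hk,
      Nat.mul_div_cancel _ (Nat.pos_of_ne_zero hk0)]
  obtain ⟨g, hg, hgo⟩ := exists_lift_primeFactors π hπ (s ^ k)
  have hgF : g ∈ frattini G := by
    apply h.mem_frattini
    · rw [← ho, ← hg]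
      exact orderOf_map_dvd π g
    · intro r hr hrg
      have h1 := hgo r hr hrg
      rw [ho] at h1
      exact (hr.dvd_mul.1 h1).imp (Nat.prime_dvd_prime_iff_eq hr h.prime_left).1
        (Nat.prime_dvd_prime_iff_eq hr h.prime_right).1
  rw [← hker, MonoidHom.mem_ker, hg] at hgF
  rw [hgF, orderOf_one] at ho
  exact h.prime_left.one_lt.ne' (Nat.eq_one_of_mul_eq_one_right ho.symm)

/-- Otherwise the preimage of `T` would centralize `P`, but the centralizer of `P` is only `frattini
G`. -/
theorem dvd_card_of_normal (h : IsFrattiniConfiguration p q P Q) (hπ : Function.Surjective π)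
    (hker : π.ker = frattini G) (T : Subgroup S) [T.Normal] (hT : T ≠ ⊥) : p ∣ Nat.card T := by
  have h1 : (frattini G).relIndex (T.comap π) = Nat.card T := by
    rw [← hker, Subgroup.relIndex_ker, Subgroup.map_comap_eq_self_of_surjective hπ]
  rw [← h1]
  apply h.dvd_relIndex_left
  rw [← hker]
  refine lt_of_le_of_ne (Subgroup.ker_le_comap _ _) fun heq => hT ?_
  rw [← Subgroup.map_comap_eq_self_of_surjective hπ T, ← heq, Subgroup.map_eq_bot_iff]

/-- A nontrivial normal subgroup has index prime to `p` and `q`, so its preimage is `G` by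
`eq_top_of_not_dvd_index`. -/
theorem isSimpleGroup (h : IsFrattiniConfiguration p q P Q) (hπ : Function.Surjective π)
    (hker : π.ker = frattini G)
    (hcp : ∀ R : Subgroup S, IsPGroup p R → IsCyclic R)
    (hcq : ∀ R : Subgroup S, IsPGroup q R → IsCyclic R) : IsSimpleGroup S := by
  have : Finite S := Finite.of_surjective π hπ
  have hnorm : ∀ T : Subgroup S, T.Normal → T ≠ ⊥ → p ∣ Nat.card T ∧ q ∣ Nat.card T :=
    fun T _ hT => ⟨h.dvd_card_of_normal hπ hker T hT, h.symm.dvd_card_of_normal hπ hker T hT⟩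
  have hnt : Nontrivial S := by
    by_contra hS
    rw [not_nontrivial_iff_subsingleton] at hS
    have h1 : frattini G = ⊤ := by
      rw [← hker, eq_top_iff]
      exact fun g _ => Subsingleton.elim _ _
    have h2 : (⊥ : Subgroup G) = ⊤ := frattini_nongenerating (by rw [h1, bot_sup_eq])
    exact h.ne_bot_left (le_bot_iff.1 (h2 ▸ le_top))
  refine { exists_pair_ne := hnt.exists_pair_ne, eq_bot_or_eq_top_of_normal := fun T hT => ?_ }
  by_cases hT1 : T = ⊥
  · exact Or.inl hT1
  right
  have hq := not_dvd_index_of_isCyclic h.prime_right h.prime_left h.ne hcq hnorm T hT1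
  have hp := not_dvd_index_of_isCyclic h.prime_left h.prime_right h.ne.symm hcp
    (fun T hT hT1 => (hnorm T hT hT1).symm) T hT1
  have htop := h.eq_top_of_not_dvd_index (M := T.comap π) (hker ▸ Subgroup.ker_le_comap _ _)
    (by rwa [Subgroup.index_comap_of_surjective _ hπ])
    (by rwa [Subgroup.index_comap_of_surjective _ hπ])
  rw [← Subgroup.map_comap_eq_self_of_surjective hπ T, htop, Subgroup.map_top_of_surjective π hπ]

theorem not_commutative (h : IsFrattiniConfiguration p q P Q) (hπ : Function.Surjective π)
    (hker : π.ker = frattini G) (hS : IsSimpleGroup S) : ¬ ∀ a b : S, a * b = b * a := by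
  intro hab
  have : Finite S := Finite.of_surjective π hπ
  let _ : CommGroup S := { (inferInstance : Group S) with mul_comm := hab }
  have hprime : (Nat.card S).Prime := IsSimpleGroup.prime_card
  have h1 := h.dvd_card_of_normal hπ hker ⊤ top_ne_bot
  have h2 := h.symm.dvd_card_of_normal hπ hker ⊤ top_ne_bot
  rw [Subgroup.card_top] at h1 h2
  exact h.ne (((Nat.prime_dvd_prime_iff_eq h.prime_left hprime).1 h1).trans
    ((Nat.prime_dvd_prime_iff_eq h.prime_right hprime).1 h2).symm)

variable {V : Type*} [AddCommGroup V] {ρ : Representation ℤ S V} {ι : Multiplicative V →* G}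

theorem fixedPointFree (h : IsFrattiniConfiguration p q P Q) (hπ : Function.Surjective π)
    (hker : π.ker = frattini G) (hι : IsConjugationModule π P ρ ι) {s : S} (hs1 : s ≠ 1)
    (hs : ∃ n, orderOf s = q ^ n) {v : V} (hv : ρ s v = v) : v = 0 := by
  obtain ⟨g, rfl, hgo⟩ := exists_lift_orderOf_eq_prime_pow π hπ h.prime_right s hs
  by_contra hv0
  apply hs1
  rw [← MonoidHom.mem_ker, hker]
  exact h.mem_frattini_of_commute (hι.mem v) (fun h1 => hv0 (hι.eq_zero h1)) hgo
    (hι.commute_of_apply_eq hv)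

theorem isFaithfulIrreducible {S V : Type v} [Group S] {π : G →* S} [AddCommGroup V]
    {ρ : Representation ℤ S V} {ι : Multiplicative V →* G}
    (h : IsFrattiniConfiguration p q P Q) (hπ : Function.Surjective π)
    (hker : π.ker = frattini G) (hι : IsConjugationModule π P ρ ι) :
    IsFaithfulIrreducibleOfPrimePower p ρ where
  card_eq := hι.card_eq ▸ h.card_left
  faithful := by
    rw [injective_iff_map_eq_one]
    intro s hs
    obtain ⟨g, rfl⟩ := hπ s
    rw [← MonoidHom.mem_ker, hker, ← h.centralizer_left]
    intro x hx
    obtain ⟨v, rfl⟩ := hι.exists_eq hx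
    exact hι.commute_of_apply_eq (by rw [hs]; rfl)
  irreducible := hι.isSimpleOrder h.ne_bot_left fun _ hN hNP => h.eq_left_of_le hN hNP

/-- A noncyclic `R` would contain commuting elements of order `q` to which the norm argument
applies; then `q` kills the nontrivial `p`-group `V`. -/
theorem isCyclic_of_isPGroup (h : IsFrattiniConfiguration p q P Q) (hπ : Function.Surjective π)
    (hker : π.ker = frattini G) (hι : IsConjugationModule π P ρ ι) (R : Subgroup S)
    (hR : IsPGroup q R) : IsCyclic R := by
  have : Finite S := Finite.of_surjective π hπ
  have hq : Fact q.Prime := ⟨h.prime_right⟩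
  obtain ⟨n, hn⟩ := IsPGroup.iff_card.1 hR
  refine IsPGroup.isCyclic_of_forall_commute h.prime_right h.odd_right n hn fun x y hxy hx hy hy1 => ?_
  by_contra hxy'
  have hzero := Representation.nsmul_eq_zero_of_fixedPointFree ρ h.prime_right
    (fun s hs1 hs v => h.fixedPointFree hπ hker hι hs1 ⟨1, by rw [pow_one, orderOf_eq_prime hs hs1]⟩)
    (x := (x : S)) (y := (y : S)) (congrArg Subtype.val hxy) (by exact_mod_cast hx)
    (by exact_mod_cast hy) (by simpa using hy1)
    (fun ⟨k, hk⟩ => hxy' ⟨k, Subtype.ext (by simpa using hk)⟩)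
  have := hι.nontrivial h.ne_bot_left
  obtain ⟨v, hv⟩ := exists_ne (0 : V)
  obtain ⟨m, hm⟩ := h.card_left
  have h1 : addOrderOf v ∣ q := addOrderOf_dvd_of_nsmul_eq_zero (hzero v)
  have h2 : addOrderOf v ∣ p ^ m := by
    rw [← hm, ← hι.card_eq]
    exact addOrderOf_dvd_natCard v
  have h3 := Nat.eq_one_of_dvd_coprimes
    (Nat.Coprime.pow_right m ((Nat.coprime_primes h.prime_right h.prime_left).2 h.ne.symm)) h1 h2
  exact hv (AddMonoid.addOrderOf_eq_one_iff.1 h3)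

/-- Vanishing would give `P` a complement in `G`, although `P` lies in `frattini G`. -/
theorem nontrivial_H2 {S V : Type} [Group S] {π : G →* S} [AddCommGroup V]
    {ρ : Representation ℤ S V} {ι : Multiplicative V →* G}
    (h : IsFrattiniConfiguration p q P Q) (hπ : Function.Surjective π)
    (hker : π.ker = frattini G) (hι : IsConjugationModule π P ρ ι) :
    Nontrivial (groupCohomology.H2 (Rep.of ρ)) := by
  have := h.normal_right
  by_contra hH
  rw [not_nontrivial_iff_subsingleton] at hH
  obtain ⟨X, hsup, hinf⟩ := hι.exists_sup_eq_top hπ (h.sup_eq.trans hker.symm) h.inf_eq_bot hH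
  rw [eq_top_of_le_frattini_of_sup_eq_top h.le_left hsup, inf_top_eq] at hinf
  exact h.ne_bot_left hinf

theorem isFrattiniTriple {S V W : Type} [Group S] {π : G →* S} [AddCommGroup V] [AddCommGroup W]
    {ρ : Representation ℤ S V} {ι : Multiplicative V →* G}
    {σ : Representation ℤ S W} {κ : Multiplicative W →* G}
    (h : IsFrattiniConfiguration p q P Q) (hπ : Function.Surjective π)
    (hker : π.ker = frattini G) (hι : IsConjugationModule π P ρ ι)
    (hκ : IsConjugationModule π Q σ κ) : IsFrattiniTriple p q ρ σ :=
  have hS : IsSimpleGroup S := h.isSimpleGroup hπ hker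
    (h.symm.isCyclic_of_isPGroup hπ hker hκ) (h.isCyclic_of_isPGroup hπ hker hι)
  { finite := Finite.of_surjective π hπ
    simple := hS
    nonabelian := h.not_commutative hπ hker hS
    module_left := h.isFaithfulIrreducible hπ hker hι
    module_right := h.symm.isFaithfulIrreducible hπ hker hκ
    omega_eq_empty := h.omega_eq_empty hπ hker
    cohomology_left := h.nontrivial_H2 hπ hker hι
    cohomology_right := h.symm.nontrivial_H2 hπ hker hκ
    fixedPointFree_left := fun _ hs1 hs _ => h.fixedPointFree hπ hker hι hs1 hs
    fixedPointFree_right := fun _ hs1 hs _ => h.symm.fixedPointFree hπ hker hκ hs1 hs }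

end IsFrattiniConfiguration

/-! ### Assembling the extension -/

theorem mainTheorem3 (p q : ℕ) (hp : p.Prime) (hq : q.Prime) (hp_odd : Odd p) (hq_odd : Odd q)
    (hpq : p ≠ q) (G : Type u) [Group G] [Finite G] (hG : IsMinimalExceptional p q G) :
    ∃ (S P Q : Type) (_ : Group S) (_ : AddCommGroup P) (_ : AddCommGroup Q)
      (ρ : Representation ℤ S P) (σ : Representation ℤ S Q)
      (E : GroupExtension (Multiplicative (P × Q)) G S),
      IsFrattiniTriple p q ρ σ ∧ IsFrattiniExtension ρ σ E := by
  obtain ⟨P, Q, h⟩ := hG.exists_isFrattiniConfiguration hp hq hp_odd hq_odd hpq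
  have := h.normal_left
  have := h.normal_right
  let S := Shrink.{0} (G ⧸ frattini G)
  let e : S ≃* G ⧸ frattini G := Shrink.mulEquiv
  let π : G →* S := e.symm.toMonoidHom.comp (QuotientGroup.mk' (frattini G))
  have hπ : Function.Surjective π := e.symm.surjective.comp (QuotientGroup.mk'_surjective _)
  have hker : π.ker = frattini G := by
    ext g
    simp [π]
  obtain ⟨V, _, ρ, ι, hι⟩ := exists_representation_of_normal π hπ P h.comm_left
    (hker.trans_le h.frattini_le_centralizer_left)
  obtain ⟨W, _, σ, κ, hκ⟩ := exists_representation_of_normal π hπ Q h.comm_right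
    (hker.trans_le h.symm.frattini_le_centralizer_left)
  let inl : Multiplicative (V × W) →* G := MonoidHom.mk'
    (fun x => ι (Multiplicative.ofAdd x.toAdd.1) * κ (Multiplicative.ofAdd x.toAdd.2))
    fun x y => by
      have hcomm := h.commute (hι.mem y.toAdd.1) (hκ.mem x.toAdd.2)
      simp only [toAdd_mul, Prod.fst_add, Prod.snd_add, ofAdd_add, map_mul]
      rw [mul_assoc, mul_assoc, ← mul_assoc (ι (Multiplicative.ofAdd y.toAdd.1)), hcomm.eq,
        mul_assoc]
  have hinl_range : inl.range = frattini G := by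
    rw [← h.sup_eq]
    ext g
    rw [Subgroup.mem_sup_of_normal_right]
    constructor
    · rintro ⟨x, rfl⟩
      exact ⟨_, hι.mem x.toAdd.1, _, hκ.mem x.toAdd.2, rfl⟩
    · rintro ⟨a, ha, b, hb, rfl⟩
      obtain ⟨v, rfl⟩ := hι.exists_eq ha
      obtain ⟨w, rfl⟩ := hκ.exists_eq hb
      exact ⟨Multiplicative.ofAdd (v, w), rfl⟩
  have hinl_inj : Function.Injective inl := by
    rw [injective_iff_map_eq_one]
    intro x hx
    change ι (Multiplicative.ofAdd x.toAdd.1) * κ (Multiplicative.ofAdd x.toAdd.2) = 1 at hx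
    have h1 : ι (Multiplicative.ofAdd x.toAdd.1) ∈ P ⊓ Q := by
      refine ⟨hι.mem _, ?_⟩
      rw [eq_inv_of_mul_eq_one_left hx]
      exact Q.inv_mem (hκ.mem _)
    rw [h.inf_eq_bot, Subgroup.mem_bot] at h1
    rw [h1, one_mul] at hx
    exact Multiplicative.toAdd.injective (Prod.ext (hι.eq_zero h1) (hκ.eq_zero hx))
  let E : GroupExtension (Multiplicative (V × W)) G S :=
    { inl := inl
      rightHom := π
      inl_injective := hinl_inj
      range_inl_eq_ker_rightHom := hinl_range.trans hker.symm
      rightHom_surjective := hπ }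
  refine ⟨S, V, W, inferInstance, inferInstance, inferInstance, ρ, σ, E,
    h.isFrattiniTriple hπ hker hι hκ, ⟨fun g x y => ?_, hinl_range.le⟩⟩
  change g * (ι (Multiplicative.ofAdd x) * κ (Multiplicative.ofAdd y)) * g⁻¹ =
    ι (Multiplicative.ofAdd (ρ (π g) x)) * κ (Multiplicative.ofAdd (σ (π g) y))
  rw [← hι.conj_eq, ← hκ.conj_eq]
  group
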